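/- Let $K$ be an algebraically closed field. A variety is a separated scheme of finite type over $K$, a point is a closed point, and all subsets below are sets of closed points with the Zariski topology. For a constructible set $W$ and $w\in W$ let $\dim_w W$ be the maximum of the dimensions of the irreducible components of $W$ containing $w$; put $\dim\emptyset=-\infty$. Let an algebraic group $G$ over $K$ act on a variety $X$, and let $\{X_j\}_{j=1,\dots,s}$ be a Rosenlicht stratification of $X$ under $G$: finitely many $G$-invariant locally closed subvarieties, of which $X$ is the disjoint union, such that each $X_j$ has a geometric quotient $p_j\colon X_j\to X_j/G$ with $X_j/G$ a variety. Let $h\colon X'\to X$ be a morphism of varieties. For $U'\subseteq X'$ open, $u'\in U'$ and $i\ge 0$ put $$V_{G,h}(u')=\{v'\in X' \mid G\cdot h(v')=G\cdot h(u')\},\qquad U'_{G,h}(i)=\{u'\in U' \mid \dim_{u'}(U'\cap V_{G,h}(u'))=i\},$$ $$G\text{-}\mathrm{par}_h(U')=\max_{i\ge 0}\{\dim U'_{G,h}(i)-i\},\qquad G\text{-}\mathrm{mod}_h(U')=\max_{1\le j\le s}\dim p_j\big(h(U'\cap h^{-1}(X_j))\big),$$ and for $x'\in X'$ let $G\text{-}\mathrm{par}_h(x')$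 and $G\text{-}\mathrm{mod}_h(x')$ be the minima of $G\text{-}\mathrm{par}_h(U')$ and $G\text{-}\mathrm{mod}_h(U')$ over all open neighbourhoods $U'$ of $x'$. Similarly, for $U\subseteq X$ open put $U(i)=\{y\in U\mid \dim_y(U\cap G\cdot y)=i\}$, $$G\text{-}\mathrm{par}(U)=\max_{i\ge 0}\{\dim U(i)-i\},\qquad G\text{-}\mathrm{mod}(U)=\max_{1\le j\le s}\dim p_j(U\cap X_j),$$ and let $G\text{-}\mathrm{par}(x)$, $G\text{-}\mathrm{mod}(x)$ be the minima of these numbers over all open neighbourhoods $U$ of $x\in X$. Then: 1. For every variety $X'$ and every morphism $h\colon X'\to X$, $G\text{-}\mathrm{par}_h(U')=G\text{-}\mathrm{mod}_h(U')$ for all open $U'\subseteq X'$, and $G\text{-}\mathrm{par}_h(x')=G\text{-}\mathrm{mod}_h(x')$ for all $x'\in X'$. 2. In particular (the case $h=\mathrm{id}$), $G\text{-}\mathrm{par}(U)=G\text{-}\mathrm{mod}(U)$ for all open $U\subseteq X$, and $G\text{-}\mathrm{par}(x)=G\text{-}\mathrm{mod}(x)$ for all $x\in X$. 3. Consequently $G\text{-}\mathrm{mod}_h(U')$,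 $G\text{-}\mathrm{mod}_h(x')$, $G\text{-}\mathrm{mod}(U)$ and $G\text{-}\mathrm{mod}(x)$ do not depend on the choice of the Rosenlicht stratification. -/

import Mathlib

open CategoryTheory MonoidalCategory CartesianMonoidalCategory MonObj AlgebraicGeometry

noncomputable section

namespace GModality

universe u

/-! ### Dimension of subsets of a topological space -/

/-- The inclusion of the possible values of a Krull dimension, `{-∞} ∪ ℕ ∪ {∞}`, into the extended
real line. It is used so that differences `dim - i` are honest differences. -/
def toEReal (d : WithBot ℕ∞) : EReal :=
  WithBot.recBotCoe ⊥ (fun n : ℕ∞ => ((n : ENNReal) : EReal)) d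

/-- The Krull dimension of a subset `W` of a topological space, for the subspace topology;
`dim ∅ = -∞`. -/
def dim {T : Type*} [TopologicalSpace T] (W : Set T) : WithBot ℕ∞ :=
  topologicalKrullDim W

/-- `dim_x W`: the maximum of the dimensions of the irreducible components of `W` (with the subspace
topology) that contain `x`. -/
def localDim {T : Type*} [TopologicalSpace T] (W : Set T) (x : T) : WithBot ℕ∞ :=
  ⨆ (Z : Set W) (_ : Z ∈ irreducibleComponents W) (_ : x ∈ (Subtype.val '' Z : Set T)),
    topologicalKrullDim Z

/-! ### Varieties, points and orbits -/

variable {K : Type u} [Field K]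

/-- An algebraic variety over `K`: a separated scheme of finite type over `K` (neither reduced nor
irreducible in general). -/
class IsVariety (X : Over (Spec (.of K))) : Prop where
  locallyOfFiniteType : LocallyOfFiniteType X.hom
  quasiCompact : QuasiCompact X.hom
  isSeparated : IsSeparated X.hom

/-- The `K`-rational points of `X`. For `K` algebraically closed and `X` a variety these are the
closed points of `X`, see `AlgebraicGeometry.pointEquivClosedPoint`. -/
abbrev Pt (X : Over (Spec (.of K))) : Type u :=
  𝟙_ (Over (Spec (.of K))) ⟶ X

/-- The point of the underlying topological space of the scheme given by a `K`-rational point. -/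
def toPoint {X : Over (Spec (.of K))} (x : Pt X) : X.left :=
  (show Spec (.of K) ⟶ X.left from x.left) (IsLocalRing.closedPoint K)

/-- The Zariski topology on the set of `K`-rational points. -/
instance (X : Over (Spec (.of K))) : TopologicalSpace (Pt X) :=
  TopologicalSpace.induced toPoint inferInstance

/-- The map on points given by a morphism. -/
def onPt {X Y : Over (Spec (.of K))} (f : X ⟶ Y) (x : Pt X) : Pt Y :=
  x ≫ f

section Action

variable (G : Over (Spec (.of K))) [GrpObj G]

/-- The orbit `G · x`, for the action of the group `G(K)` on `X(K)`. -/
def orbit {X : Over (Spec (.of K))} [ModObj G X] (x : Pt X) : Set (Pt X) :=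
  MulAction.orbit (Pt G) x

/-- A regular function `f` on the open set `U` of `X` is `G`-invariant if its pullbacks along the
action `G × X → X` and along the projection `G × X → X` agree, wherever both are defined. -/
def IsInvariantSection {X : Over (Spec (.of K))} [ModObj G X] {U : X.left.Opens}
    (f : Γ(X.left, U)) : Prop :=
  ∀ (W : (G ⊗ X).left.Opens)
    (h₁ : W ≤ γ[G, X].left ⁻¹ᵁ U) (h₂ : W ≤ (snd G X).left ⁻¹ᵁ U),
    γ[G, X].left.appLE U W h₁ f = (snd G X).left.appLE U W h₂ f

/-- `p : X ⟶ Y` is a geometric quotient of `X` by `G`, in the category of varieties. -/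
structure IsGeometricQuotient {X Y : Over (Spec (.of K))} [ModObj G X] (p : X ⟶ Y) : Prop where
  /-- The orbit space is an algebraic variety. -/
  isVariety : IsVariety Y
  /-- The morphism is constant on orbits, scheme-theoretically. -/
  smul_comp : γ[G, X] ≫ p = snd G X ≫ p
  /-- The fibres (over points in the image) are precisely the orbits. -/
  fiber_eq_orbit : ∀ x : Pt X, {y : Pt X | onPt p y = onPt p x} = orbit G x
  /-- The morphism is surjective and submersive: a subset of `Y` is open if and only if its
  preimage is. -/
  isQuotientMap : Topology.IsQuotientMap p.left.base
  /-- The structure sheaf of `Y` is the sheaf of `G`-invariant functions: pullback is injective... -/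
  app_injective : ∀ V : Y.left.Opens, Function.Injective (p.left.app V)
  /-- ... and its image consists of the `G`-invariant functions. -/
  range_app : ∀ V : Y.left.Opens,
    Set.range (p.left.app V) = {f : Γ(X.left, p.left ⁻¹ᵁ V) | IsInvariantSection G f}

/-- A Rosenlicht stratification of `X` under `G`: finitely many `G`-invariant locally closed
subvarieties `X_j` of `X`, of which `X` is the disjoint union, together with geometric quotients
`p_j : X_j ⟶ X_j / G`. -/
structure RosenlichtStratification (X : Over (Spec (.of K))) [ModObj G X] where
  /-- The number of strata. -/
  s : ℕ
  /-- The strata. -/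
  stratum : Fin s → Over (Spec (.of K))
  /-- The inclusions of the strata. -/
  incl : ∀ j, stratum j ⟶ X
  /-- Each stratum is a locally closed subscheme. -/
  isImmersion : ∀ j, IsImmersion (incl j).left
  /-- Each stratum is invariant: the action of `G` restricts to it. -/
  action : ∀ j, ModObj G (stratum j)
  /-- The inclusions are equivariant. -/
  isModHom : ∀ j, IsModHom G (incl j)
  /-- `X` is the disjoint union of the strata. -/
  existsUnique_stratum : ∀ x : Pt X, ∃! j, x ∈ Set.range (onPt (incl j))
  /-- The orbit spaces of the strata. -/
  quot : Fin s → Over (Spec (.of K))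
  /-- The quotient morphisms. -/
  proj : ∀ j, stratum j ⟶ quot j
  /-- They are geometric quotients. -/
  isGeometricQuotient : ∀ j, IsGeometricQuotient G (proj j)

variable {G} {X : Over (Spec (.of K))} [ModObj G X]

/-! ### Number of parameters and modality of an action -/

variable (G) in
/-- `U(i) = {y ∈ U | dim_y (U ∩ G · y) = i}`. -/
def parStratum (U : Set (Pt X)) (i : ℕ) : Set (Pt X) :=
  {y | y ∈ U ∧ localDim (U ∩ orbit G y) y = (i : WithBot ℕ∞)}

variable (G) in
/-- `G-par(U)`, the maximum over `i ≥ 0` of `dim U(i) - i`. -/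
def par (U : Set (Pt X)) : EReal :=
  ⨆ i : ℕ, (toEReal (dim (parStratum G U i)) - (i : EReal))

variable (G) in
/-- `G-par(x)`, the number of `G`-parameters of `x`. -/
def parAt (x : Pt X) : EReal :=
  ⨅ (U : Set (Pt X)) (_ : IsOpen U) (_ : x ∈ U), par G U

/-- `G-mod(U)`, the maximum of the dimensions of `p_j (U ∩ X_j)`. -/
def mod (R : RosenlichtStratification G X) (U : Set (Pt X)) : EReal :=
  ⨆ j : Fin R.s, toEReal (dim (onPt (R.proj j) '' (onPt (R.incl j) ⁻¹' U)))

/-- `G-mod(x)`, the `G`-modality of `x`. -/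
def modAt (R : RosenlichtStratification G X) (x : Pt X) : EReal :=
  ⨅ (U : Set (Pt X)) (_ : IsOpen U) (_ : x ∈ U), mod R U

/-! ### Number of parameters and modality with respect to a morphism -/

variable {X' : Over (Spec (.of K))}

variable (G) in
/-- `V_{G,h}(u') = {v' ∈ X' | G · h(v') = G · h(u')}`. -/
def orbitFiber (h : X' ⟶ X) (u' : Pt X') : Set (Pt X') :=
  {v' | orbit G (onPt h v') = orbit G (onPt h u')}

variable (G) in
/-- `U'_{G,h}(i) = {u' ∈ U' | dim_{u'} (U' ∩ V_{G,h}(u')) = i}`. -/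
def parStratumWrt (h : X' ⟶ X) (U' : Set (Pt X')) (i : ℕ) : Set (Pt X') :=
  {u' | u' ∈ U' ∧ localDim (U' ∩ orbitFiber G h u') u' = (i : WithBot ℕ∞)}

variable (G) in
/-- `G-par_h(U')`, the maximum over `i ≥ 0` of `dim U'_{G,h}(i) - i`. -/
def parWrt (h : X' ⟶ X) (U' : Set (Pt X')) : EReal :=
  ⨆ i : ℕ, (toEReal (dim (parStratumWrt G h U' i)) - (i : EReal))

variable (G) in
/-- `G-par_h(x')`, the number of `G`-parameters of `x'` with respect to `h`. -/
def parAtWrt (h : X' ⟶ X) (x' : Pt X') : EReal :=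
  ⨅ (U' : Set (Pt X')) (_ : IsOpen U') (_ : x' ∈ U'), parWrt G h U'

/-- `G-mod_h(U')`, the maximum of the dimensions of `p_j (h (U'_j))`, where `U'_j = U' ∩ h⁻¹(X_j)`.
Here `h (U'_j) = h (U') ∩ X_j`, regarded as a subset of `X_j`. -/
def modWrt (R : RosenlichtStratification G X) (h : X' ⟶ X) (U' : Set (Pt X')) : EReal :=
  ⨆ j : Fin R.s,
    toEReal (dim (onPt (R.proj j) '' (onPt (R.incl j) ⁻¹' (onPt h '' U'))))

/-- `G-mod_h(x')`, the `G`-modality of `x'` with respect to `h`. -/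
def modAtWrt (R : RosenlichtStratification G X) (h : X' ⟶ X) (x' : Pt X') : EReal :=
  ⨅ (U' : Set (Pt X')) (_ : IsOpen U') (_ : x' ∈ U'), modWrt R h U'

end Action

end GModality

end

/-! Both numbers are computed on the same morphisms. Let `Z_j` be the inverse image of the stratum
`X_j` in `X'`, and let `f_j` be the composite of `Z_j ⟶ X_j` with the quotient map `p_j`. The fibres
of `p_j` are orbits and strata are invariant, so for `z` in `Z_j` the set `V_{G,h}(z)` is exactly
the fibre of `f_j` through `z`; also `p_j (h (U' ∩ h⁻¹(X_j)))` is `f_j (U' ∩ Z_j)`. This is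
`RosenlichtStratification.exists_preimage_stratum`. What remains is a statement about a morphism `f`
and an open set `U` of its source: compare `dim f(U)` with `dim U(i) - i`, where `U(i)` consists of
the points of `U` at which the fibre has dimension `i`.

Upper bound (`FibreDim.dim_closure_le`): for an irreducible subset of `U(i)` with closure `C`, the
fibre dimension theorem for `f` restricted to `C` gives `dim C = e + dim (closure f(C))`, with `e` a
fibre dimension at a point of the given subset. Here `e ≤ i`, and a nonempty open part of `closure
f(C)` lies in `f(U)`. An irreducible subset of `U'(i)` has a dense part over a single stratum, so it
suffices to bound these parts.

Lower bound (`FibreDim.exists_dim_image_le`): among the components `C` meeting `U`, take one with `d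
= dim (closure f(C))` maximal, so that `dim f(U) ≤ d`. On a nonempty open part of `C` the fibre
dimension is a constant `i`, with `dim C = d + i`. That part lies in `U(i)`, whence `d ≤ dim U(i) -
i`.

The geometric input is `fibreDim_onPt`: generic fibres have the expected dimension (from the
algebraic statement `exists_ringKrullDim_quotient_add_eq`), and images contain open parts of their
closures (Chevalley). Independence of the stratification follows because the number of parameters
does not mention one. -/

noncomputable section

/-! ### Dimension theory of finitely generated domains over a field -/

namespace GModality

universe u

/-- The Krull dimension does not change in an integral extension of a normal domain. -/
theorem ringKrullDim_eq_of_isIntegral_of_isIntegrallyClosed (S B : Type*) [CommRing S] [CommRing B]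
    [IsDomain S] [IsIntegrallyClosed S] [IsDomain B] [Algebra S B] [FaithfulSMul S B]
    [Algebra.IsIntegral S B] : ringKrullDim B = ringKrullDim S := by
  apply le_antisymm
  · refine Order.krullDim_le_of_strictMono (PrimeSpectrum.comap (algebraMap S B)) fun p q h => ?_
    exact Ideal.IsIntegral.comap_lt_comap h
  -- Lying over gives a prime above the top of the chain, and going down, which holds over the
  -- normal domain `S`, lifts the rest of the chain below it.
  · refine iSup_le fun l => ?_
    obtain ⟨Q, -, hQ, hQl⟩ := Ideal.exists_ideal_over_prime_of_isIntegral_of_isPrime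
      l.last.asIdeal (⊥ : Ideal B) (by
        rw [← RingHom.ker_eq_comap_bot,
          (RingHom.injective_iff_ker_eq_bot _).mp (FaithfulSMul.algebraMap_injective S B)]
        exact bot_le)
    have : Q.LiesOver l.last.asIdeal := ⟨hQl.symm⟩
    obtain ⟨L, hL, -⟩ := Ideal.exists_ltSeries_of_hasGoingDown l Q
    rw [← hL]
    exact le_iSup (fun L : LTSeries (PrimeSpectrum B) => (L.length : WithBot ℕ∞)) L

/-- The Krull dimension of a finitely generated domain over a field is its transcendence degree. -/
theorem exists_ringKrullDim_eq_and_trdeg_eq (k B : Type u) [Field k] [CommRing B] [IsDomain B]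
    [Algebra k B] [Algebra.FiniteType k B] :
    ∃ d : ℕ, ringKrullDim B = d ∧ Algebra.trdeg k B = d := by
  obtain ⟨d, g, hg, hint⟩ := exists_integral_inj_algHom_of_fg k B
  let : Algebra (MvPolynomial (Fin d) k) B := g.toRingHom.toAlgebra
  have : IsScalarTower k (MvPolynomial (Fin d) k) B := .of_algebraMap_eq fun x => (g.commutes x).symm
  have : FaithfulSMul (MvPolynomial (Fin d) k) B := (faithfulSMul_iff_algebraMap_injective _ _).mpr hg
  have : Algebra.IsIntegral (MvPolynomial (Fin d) k) B := ⟨hint⟩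
  refine ⟨d, ?_, ?_⟩
  · rw [ringKrullDim_eq_of_isIntegral_of_isIntegrallyClosed (MvPolynomial (Fin d) k) B,
      MvPolynomial.ringKrullDim_of_isNoetherianRing, ringKrullDim_eq_zero_of_field]
    simp
  · rw [← trdeg_add_eq k (MvPolynomial (Fin d) k) (A := B), trdeg_eq_zero (R := MvPolynomial (Fin d) k), add_zero,
      MvPolynomial.trdeg_of_isDomain]
    simp

/-- Algebraic extensions of finitely generated domains preserve the Krull dimension. -/
theorem ringKrullDim_eq_of_isAlgebraic (k S B : Type u) [Field k] [CommRing S] [IsDomain S]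
    [CommRing B] [IsDomain B] [Algebra k S] [Algebra k B] [Algebra.FiniteType k S]
    [Algebra.FiniteType k B] [Algebra S B] [IsScalarTower k S B] [FaithfulSMul S B]
    [Algebra.IsAlgebraic S B] : ringKrullDim B = ringKrullDim S := by
  obtain ⟨d, hd, hd'⟩ := exists_ringKrullDim_eq_and_trdeg_eq k B
  obtain ⟨e, he, he'⟩ := exists_ringKrullDim_eq_and_trdeg_eq k S
  have h := trdeg_add_eq k S (A := B)
  rw [trdeg_eq_zero (R := S), add_zero, hd', he'] at h
  rw [hd, he, Nat.cast_inj.mp h]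

/-- Inverting `b` gives an algebraic extension of finite type, with the same fraction field. -/
theorem ringKrullDim_localizationAway_eq (k B : Type u) [Field k] [CommRing B] [IsDomain B]
    [Algebra k B] [Algebra.FiniteType k B] {b : B} (hb : b ≠ 0) :
    ringKrullDim (Localization.Away b) = ringKrullDim B := by
  have hle : Submonoid.powers b ≤ nonZeroDivisors B := powers_le_nonZeroDivisors_of_noZeroDivisors hb
  have : IsDomain (Localization.Away b) := IsLocalization.isDomain_localization hle
  have : FaithfulSMul B (Localization.Away b) :=
    (faithfulSMul_iff_algebraMap_injective _ _).mpr (IsLocalization.injective _ hle)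
  have : Algebra.IsAlgebraic B (Localization.Away b) :=
    IsLocalization.isAlgebraic _ (Submonoid.powers b)
  have : Algebra.FiniteType B (Localization.Away b) :=
    IsLocalization.finiteType_of_monoid_fg (Submonoid.powers b) _
  have : Algebra.FiniteType k (Localization.Away b) := .trans (S := B) inferInstance inferInstance
  exact ringKrullDim_eq_of_isAlgebraic k B (Localization.Away b)

/-- An algebraic extension of finite type of a domain is integral after inverting one element. -/
theorem exists_forall_isIntegral_pow_mul (S B : Type*) [CommRing S] [IsDomain S] [CommRing B]
    [Algebra S B] [Algebra.FiniteType S B] [Algebra.IsAlgebraic S B] :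
    ∃ g : S, g ≠ 0 ∧ ∀ b : B, ∃ N : ℕ, IsIntegral S (algebraMap S B g ^ N * b) := by
  obtain ⟨s, hs⟩ := Algebra.FiniteType.out (R := S) (A := B)
  -- `g` clears the denominators of the finitely many generators; products of generators need higher
  -- powers of `g`, hence the exponent `N`.
  obtain ⟨g, hg, h⟩ := Algebra.IsAlgebraic.exists_integral_multiples S s
  refine ⟨g, hg, fun b => ?_⟩
  have hb : b ∈ Algebra.adjoin S (s : Set B) := hs ▸ Algebra.mem_top
  have key (M : ℕ) (x : B) (n : ℕ) (hx : IsIntegral S (algebraMap S B g ^ n * x)) :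
      IsIntegral S (algebraMap S B g ^ (M + n) * x) := by
    rw [pow_add, _root_.mul_assoc]
    exact (isIntegral_algebraMap.pow M).mul hx
  induction hb using Algebra.adjoin_induction with
  | mem x hx => exact ⟨1, by simpa [Algebra.smul_def] using h x hx⟩
  | algebraMap r => exact ⟨0, by simpa using isIntegral_algebraMap⟩
  | add x y _ _ hx hy =>
    obtain ⟨n, hn⟩ := hx
    obtain ⟨m, hm⟩ := hy
    refine ⟨m + n, ?_⟩
    rw [mul_add]
    exact (key m x n hn).add (by rw [add_comm]; exact key n y m hm)
  | mul x y _ _ hx hy =>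
    obtain ⟨n, hn⟩ := hx
    obtain ⟨m, hm⟩ := hy
    refine ⟨n + m, ?_⟩
    rw [pow_add, _root_.mul_mul_mul_comm]
    exact hn.mul hm

/-- Going down for an extension of a normal domain that is integral after inverting `g`. -/
theorem exists_le_comap_eq_of_forall_isIntegral_pow_mul {S B : Type*} [CommRing S] [IsDomain S]
    [IsIntegrallyClosed S] [CommRing B] [IsDomain B] [Algebra S B] [FaithfulSMul S B] {g : S}
    (hg : ∀ b : B, ∃ N : ℕ, IsIntegral S (algebraMap S B g ^ N * b))
    (p : Ideal B) [hp : p.IsPrime] (hgp : algebraMap S B g ∉ p) (q : Ideal S) [q.IsPrime]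
    (hqp : q ≤ p.comap (algebraMap S B)) :
    ∃ p₁ ≤ p, p₁.IsPrime ∧ p₁.comap (algebraMap S B) = q := by
  -- `B'` and `B` agree after inverting `g`. Going down holds for the integral extension `B'` of the
  -- normal domain `S`, and the prime it yields is then carried over to `B`.
  let B' := integralClosure S B
  have : FaithfulSMul S B' := (faithfulSMul_iff_algebraMap_injective _ _).mpr fun x y h =>
    FaithfulSMul.algebraMap_injective S B congr(($h : B))
  have : Algebra.IsIntegral S B' := inferInstance
  let p' : Ideal B' := p.comap (algebraMap B' B)
  have : p'.LiesOver (p'.under S) := ⟨rfl⟩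
  obtain ⟨P, hPp, hP, hPq⟩ := Ideal.exists_ideal_le_liesOver_of_le (p := q) (q := p'.under S) p' hqp
  have hgP : algebraMap S B' g ∉ P := fun h => hgp (hPp h)
  have hgP' (N : ℕ) : algebraMap S B' g ^ N ∉ P := fun h => hgP (hP.mem_of_pow_mem _ h)
  have hmem {x : B} (hx : ∃ y ∈ P, ∃ N : ℕ, algebraMap S B g ^ N * x = y) (z : B') (M : ℕ)
      (hz : algebraMap S B g ^ M * x = z) : z ∈ P := by
    obtain ⟨y, hy, N, hN⟩ := hx
    have : algebraMap S B' g ^ N * z = algebraMap S B' g ^ M * y := by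
      apply Subtype.ext
      push_cast
      rw [← hz, ← hN]
      ring
    exact (hP.mem_or_mem (this ▸ P.mul_mem_left _ hy)).resolve_left (hgP' N)
  -- The contraction to `B` of the extension of `P` to `B[1/g] = B'[1/g]`. By `hmem`, membership
  -- does not depend on the power of `g` used.
  let p₁ : Ideal B :=
    { carrier := {x | ∃ y ∈ P, ∃ N : ℕ, algebraMap S B g ^ N * x = (y : B)}
      zero_mem' := ⟨0, P.zero_mem, 0, by simp⟩
      add_mem' := by
        rintro a b ⟨y, hy, N, hN⟩ ⟨z, hz, M, hM⟩
        refine ⟨algebraMap S B' g ^ M * y + algebraMap S B' g ^ N * z,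
          P.add_mem (P.mul_mem_left _ hy) (P.mul_mem_left _ hz), N + M, ?_⟩
        push_cast
        rw [← hN, ← hM]
        ring
      smul_mem' := by
        rintro c x ⟨y, hy, N, hN⟩
        obtain ⟨M, hM⟩ := hg c
        refine ⟨⟨_, hM⟩ * y, P.mul_mem_left _ hy, M + N, ?_⟩
        push_cast
        rw [← hN, smul_eq_mul]
        ring }
  refine ⟨p₁, ?_, ?_, ?_⟩
  · rintro x ⟨y, hy, N, hN⟩
    have h1 : (y : B) ∈ p := hPp hy
    rw [← hN] at h1
    exact (hp.mem_or_mem h1).resolve_left fun h => hgp (hp.mem_of_pow_mem _ h)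
  · refine ⟨?_, ?_⟩
    · rw [Ideal.ne_top_iff_one]
      exact fun h => hP.ne_top ((Ideal.eq_top_iff_one _).mpr (hmem h 1 0 (by simp)))
    · intro x y hxy
      obtain ⟨N, hN⟩ := hg x
      obtain ⟨M, hM⟩ := hg y
      have := hmem hxy (⟨_, hN⟩ * ⟨_, hM⟩) (N + M) (by push_cast; ring)
      exact (hP.mem_or_mem this).imp (fun h => ⟨_, h, N, rfl⟩) (fun h => ⟨_, h, M, rfl⟩)
  · rw [hPq.over]
    ext s
    constructor
    · intro h
      exact hmem h (algebraMap S B' s) 0 (by simp)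
    · intro h
      exact ⟨algebraMap S B' s, h, 0, by simp⟩

/-- The generic components of the fibres of a dominant morphism `Spec B → Spec A` of affine
varieties have dimension `dim B - dim A`. -/
theorem exists_ringKrullDim_quotient_add_eq (k A B : Type u) [Field k] [CommRing A] [IsDomain A]
    [CommRing B] [IsDomain B] [Algebra k A] [Algebra k B] [Algebra.FiniteType k A]
    [Algebra.FiniteType k B] [Algebra A B] [IsScalarTower k A B] [FaithfulSMul A B] :
    ∃ g : B, g ≠ 0 ∧ ∀ (m : Ideal A) [m.IsMaximal] (p : Ideal B),
      p ∈ (m.map (algebraMap A B)).minimalPrimes → g ∉ p →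
      ringKrullDim (B ⧸ p) + ringKrullDim A = ringKrullDim B := by
  obtain ⟨d, f, hf, hint⟩ := exists_integral_inj_algHom_of_fg k A
  let P := MvPolynomial (Fin d) k
  let : Algebra P A := f.toRingHom.toAlgebra
  have : IsScalarTower k P A := .of_algebraMap_eq fun x => (f.commutes x).symm
  have : FaithfulSMul P A := (faithfulSMul_iff_algebraMap_injective _ _).mpr hf
  have : Algebra.IsIntegral P A := ⟨hint⟩
  let : Algebra P B := ((algebraMap A B).comp (algebraMap P A)).toAlgebra
  have : IsScalarTower P A B := .of_algebraMap_eq fun x => rfl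
  have : IsScalarTower k P B := .to₁₂₄ k P A B
  have : FaithfulSMul P B := .trans P A B
  have : Algebra.FiniteType P B := .of_restrictScalars_finiteType k P B
  -- With `S = P[J]` the ring `B` is algebraic over `S`, so `dim B = |J| + d`, and `|J|` is the
  -- expected fibre dimension.
  obtain ⟨J, x, hx⟩ := exists_isTranscendenceBasis' P B
  have hJ : Finite J := by
    have h1 := hx.lift_cardinalMk_eq_trdeg
    have h2 := trdeg_lt_aleph0_of_finiteType (R := P) (S := B)
    rw [← Cardinal.lt_aleph0_iff_finite]
    simp only [Cardinal.lift_id] at h1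
    rwa [h1]
  let S := MvPolynomial J P
  let : Algebra S B := (MvPolynomial.aeval x : S →ₐ[P] B).toRingHom.toAlgebra
  have : IsScalarTower P S B := .of_algebraMap_eq fun r =>
    ((MvPolynomial.aeval x : S →ₐ[P] B).commutes r).symm
  have : FaithfulSMul S B := (faithfulSMul_iff_algebraMap_injective _ _).mpr hx.1
  have : IsScalarTower k S B := .to₁₃₄ k P S B
  have : Algebra.FiniteType S B := .of_restrictScalars_finiteType k S B
  have : Algebra.FiniteType k S := .trans (S := P) inferInstance inferInstance
  have : Algebra.IsAlgebraic S B := by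
    have := hx.isAlgebraic
    refine Algebra.IsAlgebraic.of_ringHom_of_comp_eq hx.1.aevalEquiv.toRingHom
      (RingHom.id B) hx.1.aevalEquiv.surjective Function.injective_id ?_
    ext y <;> simp [RingHom.algebraMap_toAlgebra]
  have hdimA : ringKrullDim A = d := by
    rw [ringKrullDim_eq_of_isIntegral_of_isIntegrallyClosed P A,
      MvPolynomial.ringKrullDim_of_isNoetherianRing, ringKrullDim_eq_zero_of_field]
    simp
  have hdimB : ringKrullDim B = Nat.card J + d := by
    rw [ringKrullDim_eq_of_isAlgebraic k S B, MvPolynomial.ringKrullDim_of_isNoetherianRing,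
      MvPolynomial.ringKrullDim_of_isNoetherianRing, ringKrullDim_eq_zero_of_field, zero_add,
      add_comm, Nat.card_fin]
  obtain ⟨g, hg0, hg⟩ := exists_forall_isIntegral_pow_mul S B
  refine ⟨algebraMap S B g, by simpa using hg0, fun m hm p hp hgp => ?_⟩
  have hpp : p.IsPrime := hp.1.1
  let n : Ideal P := m.comap (algebraMap P A)
  have hn : n.IsMaximal := Ideal.isMaximal_comap_of_isIntegral_of_isMaximal m
  -- The fibre of `Spec S` over `n`: the quotient `S ⧸ q` is a polynomial ring in the variables `J`
  -- over the field `P ⧸ n`, of dimension `|J|`.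
  let q : Ideal S := n.map MvPolynomial.C
  have eS : MvPolynomial J (P ⧸ n) ≃+* S ⧸ q :=
    (MvPolynomial.quotientEquivQuotientMvPolynomial n).toRingEquiv
  have : IsDomain (S ⧸ q) := MulEquiv.isDomain _ eS.symm.toMulEquiv
  have hq : q.IsPrime := (Ideal.Quotient.isDomain_iff_prime q).mp inferInstance
  have hqp : q ≤ p.comap (algebraMap S B) := by
    refine Ideal.map_le_iff_le_comap.mpr fun r hr => hp.1.2 ?_
    have e : algebraMap S B (MvPolynomial.C r) = algebraMap A B (algebraMap P A r) :=
      (IsScalarTower.algebraMap_apply P S B r).symm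
    rw [e]
    exact Ideal.mem_map_of_mem _ hr
  -- The prime `p₁` contracts to a maximal ideal of `A`, since it lies over `n` and `A` is integral
  -- over `P`; being inside `p`, it contracts to `m`. Minimality of `p` then forces `p₁ = p`, so `p`
  -- lies over `q` itself.
  obtain ⟨p₁, hp₁, hp₁', hp₁q⟩ := exists_le_comap_eq_of_forall_isIntegral_pow_mul hg p hgp q hqp
  have hmp : p.comap (algebraMap A B) = m :=
    (hm.eq_of_le (Ideal.comap_ne_top _ hpp.ne_top) (Ideal.map_le_iff_le_comap.mp hp.1.2)).symm
  have hmax : (p₁.comap (algebraMap A B)).IsMaximal := by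
    refine Ideal.isMaximal_of_isIntegral_of_isMaximal_comap (R := P) _ ?_
    have h1 : n ≤ (p₁.comap (algebraMap A B)).comap (algebraMap P A) := by
      intro r hr
      have e : algebraMap S B (MvPolynomial.C r) = algebraMap A B (algebraMap P A r) :=
        (IsScalarTower.algebraMap_apply P S B r).symm
      have : MvPolynomial.C r ∈ p₁.comap (algebraMap S B) := hp₁q ▸ Ideal.mem_map_of_mem _ hr
      rw [Ideal.mem_comap, e] at this
      exact this
    rwa [← hn.eq_of_le (Ideal.comap_ne_top _ (Ideal.comap_ne_top _ hp₁'.ne_top)) h1]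
  have hm₁ : p₁.comap (algebraMap A B) = m :=
    hmax.eq_of_le hm.ne_top (hmp ▸ Ideal.comap_mono hp₁)
  have hpp₁ : p₁ = p :=
    le_antisymm hp₁ (hp.2 ⟨hp₁', Ideal.map_le_iff_le_comap.mpr hm₁.ge⟩ hp₁)
  subst hpp₁
  have hover : p₁.LiesOver q := ⟨hp₁q.symm⟩
  have : Algebra.IsAlgebraic (S ⧸ q) (B ⧸ p₁) := by
    refine ⟨fun y => ?_⟩
    obtain ⟨b, rfl⟩ := Ideal.Quotient.mk_surjective y
    obtain ⟨N, hN⟩ := hg b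
    have hN' : IsIntegral (S ⧸ q) (Ideal.Quotient.mk q g ^ N • Ideal.Quotient.mk p₁ b) := by
      have h := (hN.map (Ideal.Quotient.mkₐ S p₁)).tower_top (A := S ⧸ q)
      rw [Ideal.Quotient.mkₐ_eq_mk, map_mul, map_pow] at h
      rw [Algebra.smul_def, map_pow]
      exact h
    refine IsAlgebraic.of_smul_isIntegral ?_ hN'
    rw [isNilpotent_iff_eq_zero]
    refine pow_ne_zero _ fun h => hgp ?_
    rw [Ideal.Quotient.eq_zero_iff_mem, ← hp₁q] at h
    exact h
  have : FaithfulSMul (S ⧸ q) (B ⧸ p₁) := inferInstance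
  rw [ringKrullDim_eq_of_isAlgebraic k (S ⧸ q) (B ⧸ p₁), ← ringKrullDim_eq_of_ringEquiv eS,
    hdimA, hdimB]
  let : Field (P ⧸ n) := Ideal.Quotient.field n
  rw [MvPolynomial.ringKrullDim_of_isNoetherianRing, ringKrullDim_eq_zero_of_field, zero_add]

end GModality
end

noncomputable section

/-! ### Dimension and local dimension of subsets of a topological space -/

namespace GModality

universe u

open TopologicalSpace Topology

section Topology

variable {T T' : Type*} [TopologicalSpace T] [TopologicalSpace T']

theorem dim_mono {W W' : Set T} (h : W ⊆ W') : dim W ≤ dim W' :=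
  (IsEmbedding.inclusion h).isInducing.topologicalKrullDim_le

theorem dim_image {f : T → T'} (hf : IsEmbedding f) (W : Set T) : dim (f '' W) = dim W := by
  symm
  have h : IsEmbedding (fun x : W => (⟨f x, x, x.2, rfl⟩ : f '' W)) :=
    .of_comp (by have := hf.continuous; fun_prop) continuous_subtype_val
      (hf.comp IsEmbedding.subtypeVal)
  refine IsHomeomorph.topologicalKrullDim_eq _
    (isHomeomorph_iff_isEmbedding_surjective.mpr ⟨h, ?_⟩)
  rintro ⟨_, x, hx, rfl⟩
  exact ⟨⟨x, hx⟩, rfl⟩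

theorem dim_range {f : T → T'} (hf : IsEmbedding f) : dim (Set.range f) = topologicalKrullDim T :=
  (IsHomeomorph.topologicalKrullDim_eq _ hf.toHomeomorph.isHomeomorph).symm

theorem dim_nonneg {W : Set T} (h : W.Nonempty) : 0 ≤ dim W := by
  obtain ⟨x, hx⟩ := h
  have : Nonempty (IrreducibleCloseds W) :=
    ⟨⟨closure {⟨x, hx⟩}, isIrreducible_singleton.closure, isClosed_closure⟩⟩
  exact Order.krullDim_nonneg

theorem dim_empty : dim (∅ : Set T) = ⊥ := by
  have : IsEmpty (IrreducibleCloseds (∅ : Set T)) := ⟨fun Z => Z.isIrreducible.nonempty.some.2⟩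
  exact Order.krullDim_eq_bot

theorem isIrreducible_image_iff {f : T → T'} (hf : IsInducing f) {S : Set T} :
    IsIrreducible (f '' S) ↔ IsIrreducible S := by
  refine ⟨fun h => ⟨h.1.of_image, ?_⟩, fun h => h.image f hf.continuous.continuousOn⟩
  intro u v hu hv ⟨x, hxS, hxu⟩ ⟨y, hyS, hyv⟩
  obtain ⟨u', hu', rfl⟩ := hf.isOpen_iff.mp hu
  obtain ⟨v', hv', rfl⟩ := hf.isOpen_iff.mp hv
  obtain ⟨_, ⟨z, hz, rfl⟩, hz'⟩ := h.2 u' v' hu' hv' ⟨f x, ⟨x, hxS, rfl⟩, hxu⟩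
    ⟨f y, ⟨y, hyS, rfl⟩, hyv⟩
  exact ⟨z, hz, hz'⟩

theorem closure_inter_of_isIrreducible {Z U : Set T} (hZ : IsIrreducible Z) (hU : IsOpen U)
    (h : (Z ∩ U).Nonempty) : closure (Z ∩ U) = closure Z :=
  (closure_mono Set.inter_subset_left).antisymm <| closure_minimal
    (subset_closure_inter_of_isPreirreducible_of_isOpen hZ.2 hU h) isClosed_closure

theorem isIrreducible_inter_of_isOpen {Z U : Set T} (hZ : IsIrreducible Z) (hU : IsOpen U)
    (h : (Z ∩ U).Nonempty) : IsIrreducible (Z ∩ U) := by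
  rw [← isIrreducible_iff_closure] at hZ ⊢
  rwa [closure_inter_of_isIrreducible (isIrreducible_iff_closure.mp hZ) hU h]

/-- The local dimension is the supremum of the dimensions of irreducible subsets through the
point. -/
theorem localDim_eq (W : Set T) (x : T) :
    localDim W x = ⨆ (Z : Set T) (_ : Z ⊆ W) (_ : IsIrreducible Z) (_ : x ∈ Z), dim Z := by
  apply le_antisymm
  · refine iSup_le fun C => iSup_le fun hC => iSup_le fun hx => ?_
    refine le_iSup_of_le (Subtype.val '' C) <| le_iSup_of_le (by simp) <|
      le_iSup_of_le (hC.1.image _ continuous_subtype_val.continuousOn) <| le_iSup_of_le hx ?_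
    rw [dim_image IsEmbedding.subtypeVal]
    rfl
  · refine iSup_le fun Z => iSup_le fun hZW => iSup_le fun hZ => iSup_le fun hx => ?_
    obtain ⟨Z, rfl⟩ : ∃ Z' : Set W, Subtype.val '' Z' = Z :=
      ⟨Subtype.val ⁻¹' Z, by simpa using hZW⟩
    obtain ⟨C, hC, hZC⟩ := exists_mem_irreducibleComponents_subset_of_isIrreducible Z
      ((isIrreducible_image_iff IsInducing.subtypeVal).mp hZ)
    refine le_iSup_of_le C <| le_iSup_of_le hC <| le_iSup_of_le (Set.image_mono hZC hx) ?_
    rw [dim_image IsEmbedding.subtypeVal]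
    exact dim_mono hZC

theorem localDim_le {W : Set T} {x : T} {n : WithBot ℕ∞}
    (h : ∀ Z ⊆ W, IsIrreducible Z → x ∈ Z → dim Z ≤ n) : localDim W x ≤ n := by
  rw [localDim_eq]
  exact iSup_le fun Z => iSup_le fun hZW => iSup_le fun hZ => iSup_le fun hx => h Z hZW hZ hx

theorem dim_le_localDim {W Z : Set T} {x : T} (hZW : Z ⊆ W) (hZ : IsIrreducible Z) (hx : x ∈ Z) :
    dim Z ≤ localDim W x := by
  rw [localDim_eq]
  exact le_iSup_of_le Z <| le_iSup_of_le hZW <| le_iSup_of_le hZ <| le_iSup_of_le hx le_rfl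

theorem localDim_mono {W W' : Set T} (h : W ⊆ W') (x : T) : localDim W x ≤ localDim W' x :=
  localDim_le fun _ hZW hZ hx => dim_le_localDim (hZW.trans h) hZ hx

theorem localDim_image {f : T → T'} (hf : IsEmbedding f) (W : Set T) (x : T) :
    localDim (f '' W) (f x) = localDim W x := by
  apply le_antisymm
  · refine localDim_le fun Z hZW hZ hx => ?_
    obtain ⟨Z, hZW', rfl⟩ := Set.subset_image_iff.mp hZW
    rw [dim_image hf]
    exact dim_le_localDim hZW' ((isIrreducible_image_iff hf.isInducing).mp hZ)
      ((hf.injective.mem_set_image).mp hx)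
  · refine localDim_le fun Z hZW hZ hx => ?_
    rw [← dim_image hf]
    exact dim_le_localDim (Set.image_mono hZW) ((isIrreducible_image_iff hf.isInducing).mpr hZ)
      ⟨x, hx, rfl⟩

/-- A chain of irreducible closed subsets lies inside its largest member, so the chains ending at
`Z` are already chains in the space `Z`. -/
theorem dim_le_of_forall_isIrreducible {S : Set T} {n : WithBot ℕ∞}
    (h : ∀ Z ⊆ S, IsIrreducible Z → dim Z ≤ n) : dim S ≤ n := by
  rw [dim, topologicalKrullDim, Order.krullDim_eq_iSup_height]
  refine iSup_le fun Z => ?_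
  rw [Order.height_eq_krullDim_Iic]
  refine le_trans ?_ (h (Subtype.val '' (Z : Set S)) (by simp)
    (Z.isIrreducible.image _ continuous_subtype_val.continuousOn))
  rw [dim_image IsEmbedding.subtypeVal]
  have key (Y : Set.Iic Z) : IsIrreducible ((↑) ⁻¹' (Y.1 : Set S) : Set (Z : Set S)) := by
    rw [← isIrreducible_image_iff IsInducing.subtypeVal]
    rw [Subtype.image_preimage_coe, Set.inter_eq_right.mpr (show (Y.1 : Set S) ⊆ Z from Y.2)]
    exact Y.1.isIrreducible
  refine Order.krullDim_le_of_strictMono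
    (fun Y => ⟨(↑) ⁻¹' (Y.1 : Set S), key Y, Y.1.isClosed.preimage continuous_subtype_val⟩) ?_
  refine Monotone.strictMono_of_injective (fun Y Y' hY => Set.preimage_mono (f := Subtype.val) hY) ?_
  intro Y Y' hYY
  have h1 : Subtype.val ⁻¹' (Y.1 : Set S) = (Subtype.val ⁻¹' (Y'.1 : Set S) : Set (Z : Set S)) :=
    congr(($hYY : Set (Z : Set S)))
  apply Subtype.ext
  apply SetLike.coe_injective
  rw [Subtype.preimage_val_eq_preimage_val_iff] at h1
  rwa [Set.inter_eq_right.mpr (show (Y.1 : Set S) ⊆ Z from Y.2),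
    Set.inter_eq_right.mpr (show (Y'.1 : Set S) ⊆ Z from Y'.2)] at h1

/-- Bounding closures allows `Z` to be replaced by a dense subset, whose own dimension could be
smaller. -/
theorem dim_le_of_forall_dim_closure_le {S : Set T} {n : WithBot ℕ∞}
    (h : ∀ Z ⊆ S, IsIrreducible Z → dim (closure Z) ≤ n) : dim S ≤ n :=
  dim_le_of_forall_isIrreducible fun Z hZS hZ => (dim_mono subset_closure).trans (h Z hZS hZ)

/-- The closures of the finitely many pieces cover `Z`, so one of them contains the irreducible set
`Z`; that piece is dense in `Z`, hence irreducible. -/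
theorem exists_isIrreducible_inter {J : Type*} [Finite J] {Z : Set T} (hZ : IsIrreducible Z)
    (S : J → Set T) (h : Z ⊆ ⋃ j, S j) :
    ∃ j, IsIrreducible (Z ∩ S j) ∧ closure (Z ∩ S j) = closure Z := by
  classical
  have := Fintype.ofFinite J
  obtain ⟨_, hj, hZj⟩ := isIrreducible_iff_sUnion_isClosed.mp hZ
    (Finset.univ.image fun j => closure (Z ∩ S j)) (by simp) (by
      intro z hz
      obtain ⟨j, hj⟩ := Set.mem_iUnion.mp (h hz)
      simp only [Finset.coe_image, Finset.coe_univ, Set.image_univ, Set.sUnion_range,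
        Set.mem_iUnion]
      exact ⟨j, subset_closure ⟨hz, hj⟩⟩)
  obtain ⟨j, -, rfl⟩ := Finset.mem_image.mp hj
  have h : closure (Z ∩ S j) = closure Z :=
    (closure_mono Set.inter_subset_left).antisymm (closure_minimal hZj isClosed_closure)
  exact ⟨j, by rwa [← isIrreducible_iff_closure, h, isIrreducible_iff_closure], h⟩

/-- A bound for the dimension of a set covered by finitely many sets. -/
theorem dim_le_of_subset_iUnion {J : Type*} [Finite J] {S : Set T} (S' : J → Set T)
    (hS : S ⊆ ⋃ j, S' j) {n : WithBot ℕ∞}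
    (h : ∀ j, ∀ Z ⊆ S' j, IsIrreducible Z → dim (closure Z) ≤ n) : dim S ≤ n := by
  refine dim_le_of_forall_dim_closure_le fun Z hZS hZ => ?_
  obtain ⟨j, hj, hj'⟩ := exists_isIrreducible_inter hZ S' (hZS.trans hS)
  rw [← hj']
  exact h j _ Set.inter_subset_right hj

/-- The dimension can be computed locally. -/
theorem dim_le_of_forall_exists_isOpen {S : Set T} {n : WithBot ℕ∞}
    (h : ∀ x ∈ S, ∃ W, IsOpen W ∧ x ∈ W ∧ dim (S ∩ W) ≤ n) : dim S ≤ n := by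
  -- Chains are counted upwards from `Z`: their members all contain `x`, hence meet `W`, and the
  -- coheight is unchanged on the open subset.
  rw [dim, topologicalKrullDim, Order.krullDim_eq_iSup_coheight]
  refine iSup_le fun Z => ?_
  obtain ⟨x, hx⟩ := Z.isIrreducible.nonempty
  obtain ⟨W, hW, hxW, hn⟩ := h x x.2
  refine le_trans ?_ hn
  let W' : Set S := Subtype.val ⁻¹' W
  have hW' : IsOpenEmbedding (Subtype.val : W' → S) :=
    (hW.preimage continuous_subtype_val).isOpenEmbedding_subtypeVal
  let Y := (IrreducibleCloseds.orderIsoOfIsOpenEmbedding _ hW').symm ⟨Z, ⟨⟨x, hxW⟩, hx⟩⟩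
  have hY : IrreducibleCloseds.map Subtype.val hW'.continuous Y = Z :=
    congr($((IrreducibleCloseds.orderIsoOfIsOpenEmbedding _ hW').apply_symm_apply
      ⟨Z, ⟨⟨x, hxW⟩, hx⟩⟩).1)
  rw [← hY, hW'.coheight_map]
  have e : S ∩ W = Subtype.val '' W' := by simp [W']
  rw [e, dim_image IsEmbedding.subtypeVal]
  exact Order.coheight_le_krullDim Y

/-- The dimension theory of the space behaves as on an algebraic variety: irreducible closed
subsets are finite-dimensional, of the same dimension as their nonempty open subsets. -/
structure DimStable (T : Type*) [TopologicalSpace T] : Prop where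
  dim_inter_eq : ∀ C U : Set T, IsIrreducible C → IsClosed C → IsOpen U → (C ∩ U).Nonempty →
    dim (C ∩ U) = dim C
  exists_dim_eq : ∀ C : Set T, IsIrreducible C → IsClosed C → ∃ d : ℕ, dim C = d

/-- Two open sets meeting an irreducible `C` meet each other inside `C`, so the local values of `d`
agree; the dimension being local, the common value is that of every nonempty open part of `C`. -/
theorem DimStable.of_local
    (h : ∀ C : Set T, IsIrreducible C → IsClosed C → ∀ x ∈ C, ∃ (W : Set T) (d : ℕ), IsOpen W ∧
      x ∈ W ∧ ∀ U, IsOpen U → (C ∩ W ∩ U).Nonempty → dim (C ∩ W ∩ U) = d) : DimStable T := by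
  have key (C : Set T) (hC : IsIrreducible C) (hC' : IsClosed C) : ∃ d : ℕ, ∀ U, IsOpen U →
      (C ∩ U).Nonempty → dim (C ∩ U) = d := by
    obtain ⟨x₀, hx₀⟩ := hC.1
    obtain ⟨W₀, d, hW₀, hxW₀, hd⟩ := h C hC hC' x₀ hx₀
    refine ⟨d, fun U hU hCU => ?_⟩
    have key (x : T) (hx : x ∈ C) : ∃ W : Set T, IsOpen W ∧ x ∈ W ∧ ∀ U, IsOpen U →
        (C ∩ W ∩ U).Nonempty → dim (C ∩ W ∩ U) = d := by
      obtain ⟨W, e, hW, hxW, he⟩ := h C hC hC' x hx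
      refine ⟨W, hW, hxW, fun U hU hne => ?_⟩
      obtain ⟨y, hy, hy'⟩ := hC.2 W W₀ hW hW₀ ⟨x, hx, hxW⟩ ⟨x₀, hx₀, hxW₀⟩
      rw [he U hU hne, ← he W₀ hW₀ ⟨y, ⟨hy, hy'.1⟩, hy'.2⟩, Set.inter_right_comm,
        hd W hW ⟨y, ⟨hy, hy'.2⟩, hy'.1⟩]
    apply le_antisymm
    · refine dim_le_of_forall_exists_isOpen fun x hx => ?_
      obtain ⟨W, hW, hxW, hd⟩ := key x hx.1
      refine ⟨W, hW, hxW, ?_⟩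
      rw [Set.inter_right_comm, hd U hU ⟨x, ⟨hx.1, hxW⟩, hx.2⟩]
    · obtain ⟨x, hx⟩ := hCU
      obtain ⟨W, hW, hxW, hd⟩ := key x hx.1
      rw [← hd U hU ⟨x, ⟨hx.1, hxW⟩, hx.2⟩]
      exact dim_mono fun y hy => ⟨hy.1.1, hy.2⟩
  refine ⟨fun C U hC hC' hU hne => ?_, fun C hC hC' => ?_⟩
  · obtain ⟨d, hd⟩ := key C hC hC'
    rw [hd U hU hne, ← Set.inter_univ C, hd _ isOpen_univ (by simpa using hC.1)]
  · obtain ⟨d, hd⟩ := key C hC hC'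
    exact ⟨d, by rw [← Set.inter_univ C, hd _ isOpen_univ (by simpa using hC.1)]⟩

namespace DimStable

/-- An irreducible subset `Z` of `W` through `x` can be replaced by `closure Z ∩ U`, which stays in
the closed set `W` and has the dimension of `closure Z`. -/
theorem localDim_inter (hT : DimStable T) {W U : Set T} (hW : IsClosed W) (hU : IsOpen U) {x : T}
    (hx : x ∈ U) : localDim (W ∩ U) x = localDim W x := by
  refine (localDim_mono Set.inter_subset_left x).antisymm (localDim_le fun Z hZW hZ hxZ => ?_)
  have hne : (closure Z ∩ U).Nonempty := ⟨x, subset_closure hxZ, hx⟩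
  refine (dim_mono subset_closure).trans ?_
  rw [← hT.dim_inter_eq _ U hZ.closure isClosed_closure hU hne]
  exact dim_le_localDim (Set.inter_subset_inter_left _ (closure_minimal hZW hW))
    (isIrreducible_inter_of_isOpen hZ.closure hU hne) ⟨subset_closure hxZ, hx⟩

/-- As the range is locally closed, the image of `closure S` is open in the closure of `f '' S`. -/
theorem dim_closure_image (hT' : DimStable T') {f : T → T'} (hf : IsEmbedding f)
    (hr : IsLocallyClosed (Set.range f)) {S : Set T} (hS : IsIrreducible S) :
    dim (closure (f '' S)) = dim (closure S) := by
  obtain ⟨U, F, hU, hF, hUF⟩ := hr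
  have hSF : closure (f '' S) ⊆ F :=
    closure_minimal ((Set.image_subset_range f S).trans (hUF ▸ Set.inter_subset_right)) hF
  have e : f '' closure S = closure (f '' S) ∩ U := by
    rw [hf.closure_eq_preimage_closure_image, Set.image_preimage_eq_inter_range, hUF]
    ext x
    exact ⟨fun h => ⟨h.1, h.2.1⟩, fun h => ⟨h.1, h.2, hSF h.1⟩⟩
  have h := hS.image f hf.continuous.continuousOn
  rw [← dim_image hf, e, hT'.dim_inter_eq _ U h.closure isClosed_closure hU]
  rw [← e]
  exact hS.1.closure.image f

end DimStable

/-- The theorem on the dimension of the fibres, for the restrictions of `f` to irreducible closed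
subsets: generic fibres have the expected local dimension, and the image contains a nonempty open
subset of its closure. -/
structure FibreDim (f : T → T') : Prop where
  continuous : Continuous f
  exists_isOpen_localDim : ∀ C : Set T, IsIrreducible C → IsClosed C →
    ∃ O, IsOpen O ∧ (C ∩ O).Nonempty ∧
      ∀ z ∈ C ∩ O, localDim (C ∩ f ⁻¹' {f z}) z + dim (closure (f '' C)) = dim C
  exists_isOpen_subset_image : ∀ C U : Set T, IsIrreducible C → IsClosed C → IsOpen U →
    (C ∩ U).Nonempty → ∃ V : Set T', IsOpen V ∧ (closure (f '' C) ∩ V).Nonempty ∧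
      closure (f '' C) ∩ V ⊆ f '' (C ∩ U)

/-- The points of `U` at which the fibre of the restriction of `f` to `U` has dimension `i`. -/
def fibreStratum (f : T → T') (U : Set T) (i : ℕ) : Set T :=
  {z | z ∈ U ∧ localDim (U ∩ f ⁻¹' {f z}) z = (i : WithBot ℕ∞)}

theorem FibreDim.dim_closure_le {f : T → T'} (hf : FibreDim f) (hT : DimStable T)
    (hT' : DimStable T') (hfib : ∀ y, IsClosed (f ⁻¹' {y})) {U : Set T} (hU : IsOpen U) {i : ℕ}
    {Z : Set T} (hZ : IsIrreducible Z) (hZU : Z ⊆ fibreStratum f U i) :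
    dim (closure Z) ≤ dim (f '' U) + i := by
  obtain ⟨x, hx⟩ := hZ.1
  obtain ⟨O, hO, hne, hdim⟩ := hf.exists_isOpen_localDim _ hZ.closure isClosed_closure
  -- The generic fibre formula is needed at a point of `Z` itself, where the fibre dimension in `U`
  -- is known to be `i`; density of `Z` in its closure provides one.
  obtain ⟨y, hyO, hyZ⟩ : (O ∩ Z).Nonempty :=
    let ⟨y, hy, hyO⟩ := hne
    mem_closure_iff.mp hy O hO hyO
  rw [← hdim y ⟨subset_closure hyZ, hyO⟩, add_comm]
  refine add_le_add ?_ ?_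
  · obtain ⟨V, hV, hVne, hVU⟩ := hf.exists_isOpen_subset_image _ U hZ.closure isClosed_closure hU
      ⟨x, subset_closure hx, (hZU hx).1⟩
    rw [← hT'.dim_inter_eq _ V (hZ.closure.image f hf.continuous.continuousOn).closure
      isClosed_closure hV hVne]
    exact dim_mono (hVU.trans (Set.image_mono Set.inter_subset_right))
  · rw [← (hZU hyZ).2, Set.inter_comm U, hT.localDim_inter (hfib _) hU (hZU hyZ).1]
    exact localDim_mono Set.inter_subset_right y

/-- A finite sum excludes the values `⊥` and `⊤`, so that fibre dimensions can be cancelled in `ℕ`.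
-/
theorem exists_nat_eq_of_add_eq {a : WithBot ℕ∞} {d c : ℕ} (h : a + d = c) :
    ∃ i : ℕ, a = i ∧ i + d = c := by
  induction a with
  | bot => simp at h
  | coe a =>
    norm_cast at h
    induction a with
    | top => simp at h
    | coe a => exact ⟨a, rfl, by exact_mod_cast h⟩

/-- A component `C` contains a nonempty open subset `W` of the whole space. Near a point of `W` the
fibre of `f` coincides with that of its restriction to `C`, whose generic dimension is `i = dim C -
d`. So an open part of `C`, of dimension `d + i`, lies in the stratum. -/
theorem FibreDim.exists_add_le_dim_fibreStratum {f : T → T'} (hf : FibreDim f)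
    [NoetherianSpace T] (hT : DimStable T) (hT' : DimStable T') (hfib : ∀ y, IsClosed (f ⁻¹' {y}))
    {U : Set T} (hU : IsOpen U) {C : Set T} (hC : C ∈ irreducibleComponents T)
    (hCU : (C ∩ U).Nonempty) :
    ∃ i d : ℕ, dim (closure (f '' C)) = d ∧ (d + i : ℕ) ≤ dim (fibreStratum f U i) := by
  have hCc := isClosed_of_mem_irreducibleComponents C hC
  have hCi : IsIrreducible C := hC.1
  have hfC : IsIrreducible (f '' C) := hCi.image f hf.continuous.continuousOn
  obtain ⟨W, hW, hWne, hWC⟩ :=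
    NoetherianSpace.exists_isOpen_nonempty_subset_irreducibleComponent C hC
  obtain ⟨O, hO, hOne, hdim⟩ := hf.exists_isOpen_localDim C hCi hCc
  obtain ⟨d, hd⟩ := hT'.exists_dim_eq _ hfC.closure isClosed_closure
  obtain ⟨c, hc⟩ := hT.exists_dim_eq C hCi hCc
  rw [hd, hc] at hdim
  have hOU : IsOpen (O ∩ U ∩ W) := (hO.inter hU).inter hW
  have hne : (C ∩ (O ∩ U ∩ W)).Nonempty := by
    refine hCi.2 _ _ (hO.inter hU) hW (hCi.2 _ _ hO hU hOne hCU) ?_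
    rwa [Set.inter_eq_right.mpr hWC]
  obtain ⟨z₀, hz₀⟩ := hne
  obtain ⟨i, -, hi⟩ := exists_nat_eq_of_add_eq (hdim z₀ ⟨hz₀.1, hz₀.2.1.1⟩)
  refine ⟨i, d, hd, ?_⟩
  rw [add_comm, hi, ← hc, ← hT.dim_inter_eq C _ hCi hCc hOU ⟨z₀, hz₀⟩]
  refine dim_mono fun z hz => ⟨hz.2.1.2, ?_⟩
  obtain ⟨j, hj, hj'⟩ := exists_nat_eq_of_add_eq (hdim z ⟨hz.1, hz.2.1.1⟩)
  rw [Set.inter_comm U, hT.localDim_inter (hfib _) hU hz.2.1.2,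
    ← hT.localDim_inter (hfib _) hOU hz.2, (by omega : i = j), ← hj,
    ← hT.localDim_inter (hCc.inter (hfib _)) hOU hz.2]
  congr 1
  ext y
  exact ⟨fun hy => ⟨⟨hWC hy.2.2, hy.1⟩, hy.2⟩, fun hy => ⟨hy.1.2, hy.2⟩⟩

theorem FibreDim.exists_dim_image_le {f : T → T'} (hf : FibreDim f) [NoetherianSpace T]
    (hT : DimStable T) (hT' : DimStable T') (hfib : ∀ y, IsClosed (f ⁻¹' {y})) {U : Set T}
    (hU : IsOpen U) (hne : U.Nonempty) :
    ∃ i d : ℕ, dim (f '' U) ≤ d ∧ (d + i : ℕ) ≤ dim (fibreStratum f U i) := by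
  classical
  have := (NoetherianSpace.finite_irreducibleComponents (α := T)).to_subtype
  obtain ⟨x, hx⟩ := hne
  have : Nonempty (irreducibleComponents T) := ⟨_, irreducibleComponent_mem_irreducibleComponents x⟩
  -- Components missing `U` receive `⊥`. Attaining the supremum at one of them would give `dim (f ''
  -- U) = ⊥`, impossible since `U` is nonempty.
  let n (C : irreducibleComponents T) : WithBot ℕ∞ :=
    if (C.1 ∩ U).Nonempty then dim (closure (f '' C)) else ⊥
  have hle : dim (f '' U) ≤ ⨆ C, n C := by
    refine dim_le_of_subset_iUnion (J := irreducibleComponents T) (fun C => f '' (C ∩ U)) ?_ ?_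
    · rintro _ ⟨x, hx, rfl⟩
      exact Set.mem_iUnion.mpr ⟨⟨_, irreducibleComponent_mem_irreducibleComponents x⟩, x,
        ⟨mem_irreducibleComponent, hx⟩, rfl⟩
    · intro C Z hZ hZirr
      refine le_trans ?_ (le_iSup n C)
      rw [show n C = _ from if_pos (hZirr.1.mono hZ).of_image]
      exact dim_mono (closure_mono (hZ.trans (Set.image_mono Set.inter_subset_left)))
  obtain ⟨C, hC⟩ := exists_eq_ciSup_of_finite (f := n)
  rw [← hC] at hle
  by_cases hCU : (C.1 ∩ U).Nonempty
  · obtain ⟨i, d, hd, h⟩ := hf.exists_add_le_dim_fibreStratum hT hT' hfib hU C.2 hCU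
    exact ⟨i, d, hd ▸ hle.trans_eq (if_pos hCU), h⟩
  · rw [show n C = ⊥ from if_neg hCU, le_bot_iff] at hle
    have := dim_nonneg (Set.Nonempty.image f ⟨x, hx⟩)
    simp [hle] at this

end Topology

end GModality
end

noncomputable section

/-! ### The points of an affine variety -/

namespace GModality

universe u

open TopologicalSpace Topology

/-- The `K`-points of the spectrum of a `K`-algebra. -/
def AffPt (K B : Type u) [Field K] [CommRing B] [Algebra K B] : Type u :=
  B →ₐ[K] K

namespace AffPt

variable {K A B : Type u} [Field K] [CommRing A] [Algebra K A] [CommRing B] [Algebra K B]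

/-- The homomorphism evaluating functions at a point. -/
def eval (z : AffPt K B) : B →ₐ[K] K := z

/-- The prime ideal of functions vanishing at a point. -/
def toPrime (z : AffPt K B) : PrimeSpectrum B :=
  ⟨RingHom.ker z.eval, RingHom.ker_isPrime _⟩

instance : TopologicalSpace (AffPt K B) := .induced toPrime inferInstance

theorem isInducing_toPrime : IsInducing (toPrime : AffPt K B → PrimeSpectrum B) := ⟨rfl⟩

theorem mem_toPrime {z : AffPt K B} {b : B} : b ∈ z.toPrime.asIdeal ↔ z.eval b = 0 := Iff.rfl

theorem toPrime_injective : Function.Injective (toPrime : AffPt K B → PrimeSpectrum B) := by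
  intro z w h
  refine AlgHom.ext (φ₁ := z.eval) (φ₂ := w.eval) fun b => ?_
  have h1 : b - algebraMap K B (z.eval b) ∈ z.toPrime.asIdeal := by
    rw [mem_toPrime, map_sub, AlgHom.commutes]
    simp
  rw [h, mem_toPrime, map_sub, AlgHom.commutes, sub_eq_zero] at h1
  exact h1.symm

theorem isEmbedding_toPrime : IsEmbedding (toPrime : AffPt K B → PrimeSpectrum B) :=
  ⟨isInducing_toPrime, toPrime_injective⟩

theorem eval_surjective (z : AffPt K B) : Function.Surjective z.eval := fun c =>
  ⟨algebraMap K B c, by simp⟩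

theorem isMaximal_toPrime (z : AffPt K B) : z.toPrime.asIdeal.IsMaximal :=
  RingHom.ker_isMaximal_of_surjective _ z.eval_surjective

/-- Nullstellensatz: the residue field is finite over the algebraically closed field `K`, hence
equal to it. -/
theorem exists_toPrime_eq [IsAlgClosed K] [Algebra.FiniteType K B] (m : Ideal B)
    [hm : m.IsMaximal] : ∃ z : AffPt K B, z.toPrime.asIdeal = m := by
  let : Field (B ⧸ m) := Ideal.Quotient.field m
  have : Module.Finite K (B ⧸ m) := finite_of_finite_type_of_isJacobsonRing K (B ⧸ m)
  let e : K ≃ₐ[K] B ⧸ m := AlgEquiv.ofBijective (Algebra.ofId K (B ⧸ m))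
    IsAlgClosed.algebraMap_bijective_of_isIntegral
  let z : AffPt K B := (e.symm : B ⧸ m →ₐ[K] K).comp (Ideal.Quotient.mkₐ K m)
  refine ⟨z, ?_⟩
  ext b
  rw [mem_toPrime]
  change e.symm (Ideal.Quotient.mk m b) = 0 ↔ _
  rw [EmbeddingLike.map_eq_zero_iff, Ideal.Quotient.eq_zero_iff_mem]

theorem range_toPrime [IsAlgClosed K] [Algebra.FiniteType K B] :
    Set.range (toPrime : AffPt K B → PrimeSpectrum B) = closedPoints (PrimeSpectrum B) := by
  ext x
  rw [mem_closedPoints_iff, PrimeSpectrum.isClosed_singleton_iff_isMaximal]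
  constructor
  · rintro ⟨z, rfl⟩
    exact z.isMaximal_toPrime
  · intro h
    obtain ⟨z, hz⟩ := exists_toPrime_eq (K := K) x.asIdeal
    exact ⟨z, PrimeSpectrum.ext hz⟩

/-- The set of points at which all functions in `I` vanish. -/
def zeros (K : Type u) [Field K] [Algebra K B] (I : Ideal B) : Set (AffPt K B) :=
  {z | I ≤ z.toPrime.asIdeal}

theorem isClosed_zeros (I : Ideal B) : IsClosed (zeros K I) := by
  have : zeros K I = toPrime ⁻¹' (PrimeSpectrum.zeroLocus (I : Set B)) := rfl
  rw [this]
  exact (PrimeSpectrum.isClosed_zeroLocus _).preimage isInducing_toPrime.continuous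

theorem isOpen_eval_ne_zero (b : B) : IsOpen {z : AffPt K B | z.eval b ≠ 0} := by
  have : {z : AffPt K B | z.eval b ≠ 0} = toPrime ⁻¹' (PrimeSpectrum.basicOpen b) := rfl
  rw [this]
  exact (PrimeSpectrum.basicOpen b).isOpen.preimage isInducing_toPrime.continuous

theorem exists_eval_ne_zero_subset {U : Set (AffPt K B)} (hU : IsOpen U) {z : AffPt K B}
    (hz : z ∈ U) : ∃ b : B, z.eval b ≠ 0 ∧ {w : AffPt K B | w.eval b ≠ 0} ⊆ U := by
  obtain ⟨V, hV, rfl⟩ := isInducing_toPrime.isOpen_iff.mp hU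
  obtain ⟨_, ⟨b, rfl⟩, hb, hbU⟩ :=
    PrimeSpectrum.isTopologicalBasis_basic_opens.exists_subset_of_mem_open
      (show z.toPrime ∈ V from hz) hV
  exact ⟨b, hb, fun w hw => hbU hw⟩

/-- The map on points induced by a homomorphism of algebras. -/
def comap (f : A →ₐ[K] B) (z : AffPt K B) : AffPt K A :=
  z.eval.comp f

@[simp]
theorem eval_comap (f : A →ₐ[K] B) (z : AffPt K B) (a : A) :
    (comap f z).eval a = z.eval (f a) := rfl

theorem continuous_comap (f : A →ₐ[K] B) : Continuous (comap f) :=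
  isInducing_toPrime.continuous_iff.mpr
    ((PrimeSpectrum.continuous_comap (f : A →+* B)).comp isInducing_toPrime.continuous)

theorem isEmbedding_comap (f : A →ₐ[K] B) (hf : IsEmbedding (PrimeSpectrum.comap (f : A →+* B))) :
    IsEmbedding (comap f) :=
  .of_comp (continuous_comap f) isInducing_toPrime.continuous (hf.comp isEmbedding_toPrime)

theorem isEmbedding_comap_mk (I : Ideal B) :
    IsEmbedding (comap (Ideal.Quotient.mkₐ K I)) :=
  isEmbedding_comap _ (PrimeSpectrum.isEmbedding_comap_of_surjective _ _
    Ideal.Quotient.mk_surjective)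

theorem range_comap_mk (I : Ideal B) :
    Set.range (comap (Ideal.Quotient.mkₐ K I)) = zeros K I := by
  ext z
  constructor
  · rintro ⟨w, rfl⟩ b hb
    rw [mem_toPrime, eval_comap, Ideal.Quotient.mkₐ_eq_mk, Ideal.Quotient.eq_zero_iff_mem.mpr hb,
      map_zero]
  · intro hz
    exact ⟨Ideal.Quotient.liftₐ I z.eval fun b hb => hz hb, AlgHom.ext fun b => rfl⟩

theorem isEmbedding_comap_away (b : B) :
    IsEmbedding (comap (Algebra.algHom K B (Localization.Away b))) :=
  isEmbedding_comap _ (PrimeSpectrum.localization_away_isOpenEmbedding _ b).isEmbedding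

theorem range_comap_away (b : B) :
    Set.range (comap (Algebra.algHom K B (Localization.Away b))) =
      {z : AffPt K B | z.eval b ≠ 0} := by
  ext z
  constructor
  · rintro ⟨w, rfl⟩ h
    exact ((IsLocalization.Away.algebraMap_isUnit (S := Localization.Away b) b).map
      w.eval).ne_zero h
  · intro hz
    have hu : ∀ y : Submonoid.powers b, IsUnit (z.eval y) := by
      rintro ⟨_, n, rfl⟩
      rw [map_pow]
      exact (isUnit_iff_ne_zero.mpr hz).pow n
    exact ⟨IsLocalization.liftAlgHom (M := Submonoid.powers b) (S := Localization.Away b) hu,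
      AlgHom.ext fun x => IsLocalization.lift_eq _ x⟩

end AffPt

open AffPt

/-- In a Jacobson space a closed set is the closure of its closed points, so restricting irreducible
closed sets to `S` loses nothing. -/
theorem topologicalKrullDim_eq_of_range_eq_closedPoints {S T : Type*} [TopologicalSpace S]
    [TopologicalSpace T] [JacobsonSpace T] {f : S → T} (hf : IsInducing f)
    (hr : Set.range f = closedPoints T) : topologicalKrullDim S = topologicalKrullDim T := by
  refine le_antisymm hf.topologicalKrullDim_le ?_
  have key (Z : IrreducibleCloseds T) : closure (f '' (f ⁻¹' Z)) = Z := by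
    rw [Set.image_preimage_eq_inter_range, hr, closure_inter_closedPoints Z.isClosed]
  refine Order.krullDim_le_of_strictMono (fun Z => ⟨f ⁻¹' Z, ?_, Z.isClosed.preimage hf.continuous⟩)
    (Monotone.strictMono_of_injective (fun Y Z h => Set.preimage_mono (f := f) h) ?_)
  · rw [← isIrreducible_image_iff hf, ← isIrreducible_iff_closure, key]
    exact Z.isIrreducible
  · intro Y Z h
    have h : f ⁻¹' (Y : Set T) = f ⁻¹' Z := congr(($h : Set S))
    apply SetLike.coe_injective
    rw [← key Y, ← key Z, h]

section Vanishing

variable {K B : Type u} [Field K] [CommRing B] [Algebra K B]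

/-- The ideal of functions vanishing on a set of points. -/
def vanishing (Z : Set (AffPt K B)) : Ideal B := ⨅ z ∈ Z, z.toPrime.asIdeal

theorem mem_vanishing {Z : Set (AffPt K B)} {b : B} : b ∈ vanishing Z ↔ ∀ z ∈ Z, z.eval b = 0 := by
  simp [vanishing, mem_toPrime, Submodule.mem_iInf]

theorem zeros_vanishing (Z : Set (AffPt K B)) : zeros K (vanishing Z) = closure Z := by
  apply Set.Subset.antisymm
  · intro z hz
    by_contra h
    obtain ⟨b, hb, hbZ⟩ := exists_eval_ne_zero_subset isClosed_closure.isOpen_compl h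
    refine hb (hz (mem_vanishing.mpr fun w hw => ?_))
    by_contra hwb
    exact hbZ hwb (subset_closure hw)
  · exact closure_minimal (fun z hz b hb => mem_vanishing.mp hb z hz) (isClosed_zeros _)

theorem isPrime_vanishing {Z : Set (AffPt K B)} (hZ : IsIrreducible Z) :
    (vanishing Z).IsPrime := by
  refine ⟨?_, ?_⟩
  · obtain ⟨z, hz⟩ := hZ.1
    rw [Ideal.ne_top_iff_one, mem_vanishing]
    intro h
    simpa using h z hz
  · intro b c hbc
    by_contra! h
    simp only [mem_vanishing, not_forall] at h
    obtain ⟨⟨z, hz, hzb⟩, w, hw, hwc⟩ := h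
    obtain ⟨y, hy, hyb, hyc⟩ := hZ.2 _ _ (isOpen_eval_ne_zero b) (isOpen_eval_ne_zero c)
      ⟨z, hz, hzb⟩ ⟨w, hw, hwc⟩
    have := mem_vanishing.mp hbc y hy
    rw [map_mul, mul_eq_zero] at this
    exact this.elim hyb hyc

end Vanishing

/-! ### Dimension, fibres and images for affine varieties -/

section AffineDim

variable {K A B : Type u} [Field K] [IsAlgClosed K] [CommRing A] [Algebra K A] [CommRing B]
  [Algebra K B] [Algebra.FiniteType K A] [Algebra.FiniteType K B]

theorem topologicalKrullDim_affPt : topologicalKrullDim (AffPt K B) = ringKrullDim B := by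
  have : IsJacobsonRing B := isJacobsonRing_of_finiteType (A := K)
  rw [topologicalKrullDim_eq_of_range_eq_closedPoints isInducing_toPrime range_toPrime,
    PrimeSpectrum.topologicalKrullDim_eq_ringKrullDim]

theorem dim_zeros (I : Ideal B) : dim (zeros K I) = ringKrullDim (B ⧸ I) := by
  rw [← range_comap_mk, dim_range (isEmbedding_comap_mk I), topologicalKrullDim_affPt]

/-- The localization at `b` is a nonzero algebra of finite type, so it has a maximal ideal, which is
a point by the Nullstellensatz. -/
theorem exists_eval_ne_zero [IsDomain B] {b : B} (hb : b ≠ 0) : ∃ z : AffPt K B, z.eval b ≠ 0 := by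
  have hle : Submonoid.powers b ≤ nonZeroDivisors B := powers_le_nonZeroDivisors_of_noZeroDivisors hb
  have : IsDomain (Localization.Away b) := IsLocalization.isDomain_localization hle
  have : Algebra.FiniteType B (Localization.Away b) :=
    IsLocalization.finiteType_of_monoid_fg (Submonoid.powers b) _
  have : Algebra.FiniteType K (Localization.Away b) := .trans (S := B) inferInstance inferInstance
  obtain ⟨m, hm⟩ := Ideal.exists_maximal (Localization.Away b)
  obtain ⟨z, -⟩ := exists_toPrime_eq (K := K) m
  have h : comap (Algebra.algHom K B (Localization.Away b)) z ∈ {z : AffPt K B | z.eval b ≠ 0} := by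
    rw [← range_comap_away]
    exact ⟨z, rfl⟩
  exact ⟨_, h⟩

theorem isIrreducible_univ_affPt [IsDomain B] : IsIrreducible (Set.univ : Set (AffPt K B)) := by
  refine ⟨?_, ?_⟩
  · obtain ⟨z, -⟩ := exists_eval_ne_zero (K := K) (one_ne_zero (α := B))
    exact ⟨z, trivial⟩
  · rintro U V hU hV ⟨z, -, hz⟩ ⟨w, -, hw⟩
    obtain ⟨b, hb, hbU⟩ := exists_eval_ne_zero_subset hU hz
    obtain ⟨c, hc, hcV⟩ := exists_eval_ne_zero_subset hV hw
    obtain ⟨y, hy⟩ := exists_eval_ne_zero (K := K) (b := b * c)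
      (mul_ne_zero (by rintro rfl; simp at hb) (by rintro rfl; simp at hc))
    rw [map_mul] at hy
    exact ⟨y, trivial, hbU (left_ne_zero_of_mul hy), hcV (right_ne_zero_of_mul hy)⟩

theorem dim_eq_of_isOpen [IsDomain B] {U : Set (AffPt K B)} (hU : IsOpen U) (hne : U.Nonempty) :
    dim U = ringKrullDim B := by
  apply le_antisymm
  · rw [← topologicalKrullDim_affPt (K := K)]
    exact topologicalKrullDim_subspace_le _ U
  · obtain ⟨z, hz⟩ := hne
    obtain ⟨b, hb, hbU⟩ := exists_eval_ne_zero_subset hU hz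
    have : Algebra.FiniteType B (Localization.Away b) :=
      IsLocalization.finiteType_of_monoid_fg (Submonoid.powers b) _
    have : Algebra.FiniteType K (Localization.Away b) := .trans (S := B) inferInstance inferInstance
    rw [← ringKrullDim_localizationAway_eq K B (b := b) (by rintro rfl; simp at hb),
      ← topologicalKrullDim_affPt (K := K), ← dim_range (isEmbedding_comap_away b),
      range_comap_away]
    exact dim_mono hbU

theorem isIrreducible_zeros (p : Ideal B) [p.IsPrime] : IsIrreducible (zeros K p) := by
  rw [← range_comap_mk, ← Set.image_univ, isIrreducible_image_iff (isEmbedding_comap_mk p).isInducing]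
  exact isIrreducible_univ_affPt

/-- The components through `z` of its fibre correspond to the minimal primes over the extension of
the maximal ideal of `comap f z` that are contained in the ideal of `z`. None of these contains `g`
when `g` does not vanish at `z`, so all have dimension `dim B - dim A`. -/
theorem exists_isOpen_localDim_comap [IsDomain A] [IsDomain B] (f : A →ₐ[K] B)
    (hf : Function.Injective f) : ∃ O : Set (AffPt K B), IsOpen O ∧ O.Nonempty ∧
      ∀ z ∈ O, localDim (comap f ⁻¹' {comap f z}) z + ringKrullDim A = ringKrullDim B := by
  let : Algebra A B := f.toRingHom.toAlgebra
  have : IsScalarTower K A B := .of_algebraMap_eq fun x => (f.commutes x).symm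
  have : FaithfulSMul A B := (faithfulSMul_iff_algebraMap_injective _ _).mpr hf
  obtain ⟨g, hg, h⟩ := exists_ringKrullDim_quotient_add_eq K A B
  refine ⟨_, isOpen_eval_ne_zero g, exists_eval_ne_zero hg, fun z hz => ?_⟩
  have hm := (comap f z).isMaximal_toPrime
  have hle {w : AffPt K B} : w ∈ comap f ⁻¹' {comap f z} ↔
      (comap f z).toPrime.asIdeal.map (algebraMap A B) ≤ w.toPrime.asIdeal := by
    rw [Ideal.map_le_iff_le_comap]
    constructor
    · rintro (hw : comap f w = comap f z)
      rw [← hw]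
      rfl
    · intro hw
      apply toPrime_injective
      exact PrimeSpectrum.ext (hm.eq_of_le (comap f w).isMaximal_toPrime.ne_top hw).symm
  have hgp {p : Ideal B} (hp : p ≤ z.toPrime.asIdeal) : g ∉ p := fun h => hz (hp h)
  obtain ⟨p, hp, hpz⟩ := Ideal.exists_minimalPrimes_le (hle.mp (rfl : comap f z = comap f z))
  have hpp : p.IsPrime := hp.1.1
  rw [← h _ p hp (hgp hpz)]
  congr 1
  apply le_antisymm
  · refine localDim_le fun Z hZ hZirr hzZ => (dim_mono subset_closure).trans ?_
    have hprime := isPrime_vanishing hZirr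
    have hv : (comap f z).toPrime.asIdeal.map (algebraMap A B) ≤ vanishing Z := by
      refine fun b hb => mem_vanishing.mpr fun w hw => ?_
      exact hle.mp (hZ hw) hb
    obtain ⟨p', hp', hpz'⟩ := Ideal.exists_minimalPrimes_le hv
    have hv' : vanishing Z ≤ z.toPrime.asIdeal := fun b hb => mem_vanishing.mp hb z hzZ
    have h1 := h _ p hp (hgp hpz)
    have h2 := h _ p' hp' (hgp (hpz'.trans hv'))
    have h3 : ringKrullDim (B ⧸ p') = ringKrullDim (B ⧸ p) := by
      obtain ⟨d, hd, -⟩ := exists_ringKrullDim_eq_and_trdeg_eq K A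
      obtain ⟨e, he, -⟩ := exists_ringKrullDim_eq_and_trdeg_eq K B
      rw [hd, he] at h1 h2
      obtain ⟨i, hi, hi'⟩ := exists_nat_eq_of_add_eq h1
      obtain ⟨j, hj, hj'⟩ := exists_nat_eq_of_add_eq h2
      rw [hi, hj, (by omega : i = j)]
    rw [← zeros_vanishing, dim_zeros, ← h3]
    exact ringKrullDim_le_of_surjective (Ideal.Quotient.factor hpz')
      (Ideal.Quotient.factor_surjective hpz')
  · rw [← dim_zeros (K := K)]
    exact dim_le_localDim (fun w hw => hle.mpr (hp.1.2.trans hw)) (isIrreducible_zeros p) hpz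

/-- Chevalley: the image of `Spec B` is constructible and contains the generic point of `Spec A`,
hence a nonempty basic open set. -/
theorem exists_eval_ne_zero_subset_range [IsDomain A] [IsDomain B] (f : A →ₐ[K] B)
    (hf : Function.Injective f) :
    ∃ a : A, a ≠ 0 ∧ {z : AffPt K A | z.eval a ≠ 0} ⊆ Set.range (comap f) := by
  have : IsNoetherianRing A := Algebra.FiniteType.isNoetherianRing K A
  have hfp : (f : A →+* B).FinitePresentation :=
    RingHom.FinitePresentation.of_finiteType.mp
      (RingHom.FiniteType.of_comp_finiteType (f := algebraMap K A) (by
        rw [AlgHom.comp_algebraMap]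
        exact RingHom.finiteType_algebraMap.mpr inferInstance))
  obtain ⟨S, hS⟩ := PrimeSpectrum.exists_constructibleSetData_iff.mpr
    (PrimeSpectrum.isConstructible_range_comap hfp)
  have hbot : (⊥ : PrimeSpectrum A) ∈ S.toSet := by
    rw [hS]
    refine ⟨⊥, PrimeSpectrum.ext ?_⟩
    exact (RingHom.injective_iff_ker_eq_bot _).mp hf
  obtain ⟨C, hC, hC'⟩ := Set.mem_iUnion₂.mp hbot
  -- The piece containing the zero ideal can impose no nontrivial equation, so it is the basic open
  -- set of `C.f`.
  have hCg : ∀ i, C.g i = 0 := fun i => hC'.1 ⟨i, rfl⟩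
  have hCf : C.f ≠ 0 := fun h => hC'.2 (by simp [h])
  refine ⟨C.f, hCf, fun z hz => ?_⟩
  have hzS : z.toPrime ∈ Set.range (PrimeSpectrum.comap (f : A →+* B)) := by
    rw [← hS]
    refine Set.mem_iUnion₂.mpr ⟨C, hC, ?_, ?_⟩
    · rintro _ ⟨i, rfl⟩
      simp [hCg]
    · rintro h
      exact hz (mem_toPrime.mp (by simpa using h))
  obtain ⟨q, hq⟩ := hzS
  -- The prime `q` over `z` need not be a closed point; any maximal ideal above it still lies over
  -- `z`, whose ideal is maximal.
  obtain ⟨m, hm, hqm⟩ := q.asIdeal.exists_le_maximal q.isPrime.ne_top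
  obtain ⟨w, rfl⟩ := exists_toPrime_eq (K := K) m
  refine ⟨w, toPrime_injective (PrimeSpectrum.ext ?_)⟩
  refine (z.isMaximal_toPrime.eq_of_le (comap f w).isMaximal_toPrime.ne_top ?_).symm
  rw [← hq]
  exact Ideal.comap_mono hqm

theorem exists_eval_ne_zero_subset_image [IsDomain A] [IsDomain B] (f : A →ₐ[K] B)
    (hf : Function.Injective f) {U : Set (AffPt K B)} (hU : IsOpen U) (hne : U.Nonempty) :
    ∃ a : A, a ≠ 0 ∧ {z : AffPt K A | z.eval a ≠ 0} ⊆ comap f '' U := by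
  obtain ⟨z, hz⟩ := hne
  obtain ⟨b, hb, hbU⟩ := exists_eval_ne_zero_subset hU hz
  have hb0 : b ≠ 0 := by rintro rfl; simp at hb
  have hle : Submonoid.powers b ≤ nonZeroDivisors B :=
    powers_le_nonZeroDivisors_of_noZeroDivisors hb0
  have : IsDomain (Localization.Away b) := IsLocalization.isDomain_localization hle
  have : Algebra.FiniteType B (Localization.Away b) :=
    IsLocalization.finiteType_of_monoid_fg (Submonoid.powers b) _
  have : Algebra.FiniteType K (Localization.Away b) := .trans (S := B) inferInstance inferInstance
  obtain ⟨a, ha, h⟩ := exists_eval_ne_zero_subset_range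
    ((Algebra.algHom K B (Localization.Away b)).comp f) ((IsLocalization.injective _ hle).comp hf)
  refine ⟨a, ha, h.trans ?_⟩
  rintro _ ⟨w, rfl⟩
  refine ⟨comap (Algebra.algHom K B (Localization.Away b)) w, hbU ?_, rfl⟩
  rw [← range_comap_away]
  exact ⟨w, rfl⟩

end AffineDim

end GModality
end

noncomputable section

/-! ### Affine charts -/

namespace GModality

universe u

open TopologicalSpace Topology AffPt

variable {K : Type u} [Field K]

theorem isInducing_toPoint (X : Over (Spec (.of K))) : IsInducing (toPoint : Pt X → X.left) := ⟨rfl⟩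

theorem toPoint_onPt {X Y : Over (Spec (.of K))} (f : X ⟶ Y) (x : Pt X) :
    toPoint (onPt f x) = f.left (toPoint x) := by
  rfl

theorem continuous_onPt {X Y : Over (Spec (.of K))} (f : X ⟶ Y) : Continuous (onPt f) := by
  rw [(isInducing_toPoint Y).continuous_iff]
  have : toPoint ∘ onPt f = f.left ∘ toPoint := funext (toPoint_onPt f)
  rw [this]
  exact f.left.continuous.comp (isInducing_toPoint X).continuous

theorem pt_left_comp_hom {X : Over (Spec (.of K))} (x : Pt X) :
    (show Spec (.of K) ⟶ X.left from x.left) ≫ X.hom = 𝟙 _ := by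
  exact Over.w x

theorem toPoint_injective [IsAlgClosed K] (X : Over (Spec (.of K))) [LocallyOfFiniteType X.hom] :
    Function.Injective (toPoint : Pt X → X.left) := by
  intro x y h
  apply Over.OverMorphism.ext
  exact ext_of_apply_closedPoint_eq X.hom (pt_left_comp_hom x) (pt_left_comp_hom y) h

theorem range_toPoint [IsAlgClosed K] (X : Over (Spec (.of K))) [LocallyOfFiniteType X.hom] :
    Set.range (toPoint : Pt X → X.left) = closedPoints X.left := by
  ext x
  constructor
  · rintro ⟨y, rfl⟩
    exact (pointEquivClosedPoint X.hom ⟨y.left, pt_left_comp_hom y⟩).2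
  · intro hx
    refine ⟨Over.homMk ((pointEquivClosedPoint X.hom).symm ⟨x, hx⟩).1
      ((pointEquivClosedPoint X.hom).symm ⟨x, hx⟩).2, ?_⟩
    exact congr(($((pointEquivClosedPoint X.hom).apply_symm_apply ⟨x, hx⟩)).1)

theorem isClosed_singleton_pt [IsAlgClosed K] {X : Over (Spec (.of K))} [LocallyOfFiniteType X.hom]
    (x : Pt X) : IsClosed {x} := by
  have h : toPoint x ∈ closedPoints X.left := range_toPoint X ▸ ⟨x, rfl⟩
  have e : {x} = toPoint ⁻¹' {toPoint x} := by
    ext y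
    exact (toPoint_injective X).eq_iff.symm
  rw [e]
  exact h.preimage (isInducing_toPoint X).continuous

section Chart

variable {X : Over (Spec (.of K))} {B : CommRingCat.{u}} [Algebra K B] (j : Spec B ⟶ X.left)
  (hj : j ≫ X.hom = Spec.map (CommRingCat.ofHom (algebraMap K B)))

/-- The point of `X` given by a point of an affine scheme over `X`. -/
def chartPt (z : AffPt K B) : Pt X :=
  Over.homMk (Spec.map (CommRingCat.ofHom z.eval.toRingHom) ≫ j) (by
    rw [Category.assoc, hj, ← Spec.map_comp, ← CommRingCat.ofHom_comp]
    have : z.eval.toRingHom.comp (algebraMap K B) = RingHom.id K := z.eval.comp_algebraMap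
    rw [this]
    exact Spec.map_id _)

theorem toPoint_chartPt (z : AffPt K B) : toPoint (chartPt j hj z) = j z.toPrime := by
  have : Spec.map (CommRingCat.ofHom z.eval.toRingHom) (IsLocalRing.closedPoint K) = z.toPrime := by
    refine PrimeSpectrum.ext (Ideal.ext fun b => ?_)
    change z.eval b ∈ IsLocalRing.maximalIdeal K ↔ z.eval b = 0
    rw [IsLocalRing.mem_maximalIdeal, mem_nonunits_iff, isUnit_iff_ne_zero, not_not]
  rw [← this]
  rfl

theorem range_chartPt [IsOpenImmersion j] :
    Set.range (chartPt j hj) = toPoint ⁻¹' (Set.range j) := by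
  ext x
  constructor
  · rintro ⟨z, rfl⟩
    exact ⟨z.toPrime, (toPoint_chartPt j hj z).symm⟩
  · intro hx
    have hx' : Set.range (show Spec (.of K) ⟶ X.left from x.left) ⊆ Set.range j := by
      rintro _ ⟨y, rfl⟩
      rwa [Subsingleton.elim y (IsLocalRing.closedPoint K)]
    let g : B ⟶ .of K := Spec.preimage (IsOpenImmersion.lift j _ hx')
    have hg : Spec.map g ≫ j = x.left := by
      rw [Spec.map_preimage, IsOpenImmersion.lift_fac]
    have hg' : g.hom.comp (algebraMap K B) = RingHom.id K := by
      have h := pt_left_comp_hom x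
      rw [← hg, Category.assoc, hj, ← Spec.map_comp, ← Spec.map_id, Spec.map_inj] at h
      exact congr(($h).hom)
    let z : AffPt K B := AlgHom.mk g.hom fun c => congr($hg' c)
    exact ⟨z, Over.OverMorphism.ext hg⟩

theorem isOpenEmbedding_chartPt [IsOpenImmersion j] : IsOpenEmbedding (chartPt j hj) := by
  have e : toPoint ∘ chartPt j hj = j ∘ toPrime := funext (toPoint_chartPt j hj)
  have hcont : Continuous (chartPt j hj) := by
    rw [(isInducing_toPoint X).continuous_iff, e]
    exact j.continuous.comp isInducing_toPrime.continuous
  have hemb : IsEmbedding (chartPt j hj) := by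
    refine .of_comp hcont (isInducing_toPoint X).continuous ?_
    rw [e]
    exact j.isOpenEmbedding.isEmbedding.comp isEmbedding_toPrime
  refine ⟨hemb, ?_⟩
  rw [range_chartPt]
  exact j.isOpenEmbedding.isOpen_range.preimage (isInducing_toPoint X).continuous

end Chart

/-- An affine open of `X` is chosen inside the inverse image of an affine open of `Y`. Only the
topology of the two charts and the comorphism `φ` are retained, which is all that the dimension
arguments need. -/
theorem exists_chart {X Y : Over (Spec (.of K))} [LocallyOfFiniteType X.hom]
    [LocallyOfFiniteType Y.hom] (f : X ⟶ Y) (x : Pt X) :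
    ∃ (A B : Type u) (_ : CommRing A) (_ : CommRing B) (_ : Algebra K A) (_ : Algebra K B)
      (_ : Algebra.FiniteType K A) (_ : Algebra.FiniteType K B) (φ : A →ₐ[K] B)
      (a : AffPt K A → Pt Y) (b : AffPt K B → Pt X), IsOpenEmbedding a ∧ IsOpenEmbedding b ∧
        x ∈ Set.range b ∧ ∀ z, onPt f (b z) = a (comap φ z) := by
  obtain ⟨_, ⟨V, hV, rfl⟩, hxV, -⟩ := Y.left.isBasis_affineOpens.exists_subset_of_mem_open
    (Set.mem_univ (toPoint (onPt f x))) isOpen_univ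
  obtain ⟨_, ⟨W, hW, rfl⟩, hxW, hWV⟩ := X.left.isBasis_affineOpens.exists_subset_of_mem_open
    (show toPoint x ∈ (f.left ⁻¹ᵁ V : Set X.left) from hxV) (f.left ⁻¹ᵁ V).isOpen
  have key {Z : Over (Spec (.of K))} [LocallyOfFiniteType Z.hom] {U : Z.left.Opens}
      (hU : IsAffineOpen U) : ∃ _ : Algebra K Γ(Z.left, U), Algebra.FiniteType K Γ(Z.left, U) ∧
        hU.fromSpec ≫ Z.hom = Spec.map (CommRingCat.ofHom (algebraMap K Γ(Z.left, U))) := by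
    let g : CommRingCat.of K ⟶ Γ(Z.left, U) := Spec.preimage (hU.fromSpec ≫ Z.hom)
    have hg : Spec.map g = hU.fromSpec ≫ Z.hom := Spec.map_preimage _
    have hft : g.hom.FiniteType := by
      rw [← HasRingHomProperty.Spec_iff (P := @LocallyOfFiniteType), hg]
      infer_instance
    exact ⟨g.hom.toAlgebra, hft, hg.symm⟩
  obtain ⟨algA, hA, hA'⟩ := key hV
  obtain ⟨algB, hB, hB'⟩ := key hW
  have := hV.isOpenImmersion_fromSpec
  have := hW.isOpenImmersion_fromSpec
  have hfac := IsAffineOpen.SpecMap_appLE_fromSpec f.left hV hW hWV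
  let φ : Γ(Y.left, V) →ₐ[K] Γ(X.left, W) := AlgHom.mk (f.left.appLE V W hWV).hom fun c => by
    have h : Spec.map (f.left.appLE V W hWV) ≫ Spec.map (CommRingCat.ofHom (algebraMap K _)) =
        Spec.map (CommRingCat.ofHom (algebraMap K _)) := by
      rw [← hA', ← hB', ← Category.assoc, hfac, Category.assoc, Over.w f]
    rw [← Spec.map_comp, Spec.map_inj] at h
    exact congr(($h).hom c)
  refine ⟨Γ(Y.left, V), Γ(X.left, W), inferInstance, inferInstance, algA, algB, hA, hB, φ,
    chartPt hV.fromSpec hA', chartPt hW.fromSpec hB', isOpenEmbedding_chartPt _ _,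
    isOpenEmbedding_chartPt _ _, ?_, fun z => ?_⟩
  · rw [range_chartPt, Set.mem_preimage, hW.range_fromSpec]
    exact hxW
  · apply Over.OverMorphism.ext
    change (Spec.map _ ≫ hW.fromSpec) ≫ f.left = Spec.map _ ≫ hV.fromSpec
    rw [Category.assoc, ← hfac, ← Category.assoc, ← Spec.map_comp]
    rfl

end GModality
end

noncomputable section

/-! ### Dimension theory on the points of a variety -/

namespace GModality

universe u

open TopologicalSpace Topology AffPt

variable {K : Type u} [Field K]

/-- Near any of its points, a closed irreducible subset is an integral affine variety, and the
restriction of a morphism to it is a dominant morphism of integral affine varieties. -/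
theorem exists_chart_of_isIrreducible {X Y : Over (Spec (.of K))} [LocallyOfFiniteType X.hom]
    [LocallyOfFiniteType Y.hom] (f : X ⟶ Y) {C : Set (Pt X)} (hC : IsIrreducible C)
    (hC' : IsClosed C) {x : Pt X} (hx : x ∈ C) :
    ∃ (A B : Type u) (_ : CommRing A) (_ : CommRing B) (_ : Algebra K A) (_ : Algebra K B)
      (_ : Algebra.FiniteType K A) (_ : Algebra.FiniteType K B) (_ : IsDomain A) (_ : IsDomain B)
      (φ : A →ₐ[K] B) (a : AffPt K A → Pt Y) (b : AffPt K B → Pt X) (V : Set (Pt Y))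
      (W : Set (Pt X)), Function.Injective φ ∧ IsEmbedding a ∧ IsEmbedding b ∧ IsOpen V ∧
        IsOpen W ∧ x ∈ W ∧ Set.range a = closure (onPt f '' C) ∩ V ∧ Set.range b = C ∩ W ∧
        ∀ z, onPt f (b z) = a (comap φ z) := by
  obtain ⟨A, B, _, _, _, _, _, _, φ, a, b, ha, hb, hxb, hab⟩ := exists_chart f x
  let Z : Set (AffPt K B) := b ⁻¹' C
  have hZ : IsIrreducible Z :=
    ⟨let ⟨z, hz⟩ := hxb; ⟨z, by rwa [← hz] at hx⟩, hC.2.preimage hb⟩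
  have hZ' : IsClosed Z := hC'.preimage hb.continuous
  let q : Ideal B := vanishing Z
  have hq : q.IsPrime := isPrime_vanishing hZ
  have hzq : zeros K q = Z := by rw [zeros_vanishing, hZ'.closure_eq]
  -- Contracting `q` makes `A ⧸ p → B ⧸ q` injective. The zeros of `p` are the chart's part of
  -- `closure (onPt f '' C)`, because `C ∩ Set.range b` is dense in `C`.
  let p : Ideal A := q.comap φ
  have hzp : zeros K p = a ⁻¹' closure (onPt f '' C) := by
    have h1 : p = vanishing (comap φ '' Z) := by
      ext c
      change φ c ∈ vanishing Z ↔ _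
      simp [mem_vanishing]
    have h2 : a '' (comap φ '' Z) = onPt f '' (C ∩ Set.range b) := by
      rw [← Set.image_preimage_eq_inter_range, ← Set.image_comp, ← Set.image_comp]
      exact congr_arg (· '' Z) (funext fun z => (hab z).symm)
    rw [h1, zeros_vanishing, ha.isInducing.closure_eq_preimage_closure_image, h2]
    congr 1
    apply Set.Subset.antisymm (closure_mono (Set.image_mono Set.inter_subset_left))
    refine closure_minimal ?_ isClosed_closure
    refine (Set.image_mono ?_).trans (image_closure_subset_closure_image (continuous_onPt f))
    rw [closure_inter_of_isIrreducible hC hb.isOpen_range ⟨x, hx, hxb⟩]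
    exact subset_closure
  have : (q.comap φ).IsPrime := hq.comap φ
  refine ⟨A ⧸ p, B ⧸ q, inferInstance, inferInstance, inferInstance, inferInstance, inferInstance,
    inferInstance, inferInstance, inferInstance, Ideal.quotientMapₐ q φ le_rfl,
    a ∘ comap (Ideal.Quotient.mkₐ K p), b ∘ comap (Ideal.Quotient.mkₐ K q), Set.range a,
    Set.range b, Ideal.quotientMap_injective, ha.isEmbedding.comp (isEmbedding_comap_mk p),
    hb.isEmbedding.comp (isEmbedding_comap_mk q), ha.isOpen_range, hb.isOpen_range, hxb, ?_, ?_, ?_⟩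
  · rw [Set.range_comp, range_comap_mk, hzp, Set.image_preimage_eq_inter_range]
  · rw [Set.range_comp, range_comap_mk, hzq, Set.image_preimage_eq_inter_range]
  · intro z
    exact hab _

theorem noetherianSpace_pt (X : Over (Spec (.of K))) [LocallyOfFiniteType X.hom]
    [QuasiCompact X.hom] : NoetherianSpace (Pt X) := by
  have : IsLocallyNoetherian X.left := LocallyOfFiniteType.isLocallyNoetherian X.hom
  have : CompactSpace X.left := QuasiCompact.compactSpace_of_compactSpace X.hom
  have : IsNoetherian X.left := {}
  exact (isInducing_toPoint X).noetherianSpace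

variable [IsAlgClosed K]

/-- By `DimStable.of_local` it is enough to look in a chart, where `C` is an integral affine variety
and every nonempty open subset has the dimension of its coordinate ring. -/
theorem dimStable_pt (X : Over (Spec (.of K))) [LocallyOfFiniteType X.hom] : DimStable (Pt X) := by
  refine .of_local fun C hC hC' x hx => ?_
  obtain ⟨A, B, _, _, _, _, _, _, _, _, φ, a, b, V, W, -, -, hb, -, hW, hxW, -, hbC, -⟩ :=
    exists_chart_of_isIrreducible (𝟙 X) hC hC' hx
  obtain ⟨d, hd, -⟩ := exists_ringKrullDim_eq_and_trdeg_eq K B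
  refine ⟨W, d, hW, hxW, fun U hU hne => ?_⟩
  rw [← hbC, Set.inter_comm, ← Set.image_preimage_eq_inter_range] at hne ⊢
  rw [dim_image hb, dim_eq_of_isOpen (hU.preimage hb.continuous) hne.of_image, hd]

theorem isClosed_onPt_fibre {X Y : Over (Spec (.of K))} [LocallyOfFiniteType Y.hom] (f : X ⟶ Y)
    (y : Pt Y) : IsClosed (onPt f ⁻¹' {y}) :=
  (isClosed_singleton_pt y).preimage (continuous_onPt f)

/-- Both assertions ask only for some nonempty open set, so one chart suffices: there `C` and the
closure of its image are integral affine varieties and the comorphism is injective. Passing to the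
chart changes neither the dimensions nor the local dimensions. -/
theorem fibreDim_onPt {X Y : Over (Spec (.of K))} [LocallyOfFiniteType X.hom]
    [LocallyOfFiniteType Y.hom] (f : X ⟶ Y) : FibreDim (onPt f) := by
  refine ⟨continuous_onPt f, fun C hC hC' => ?_, fun C U hC hC' hU hne => ?_⟩
  · obtain ⟨x, hx⟩ := hC.1
    obtain ⟨A, B, _, _, _, _, _, _, _, _, φ, a, b, V, W, hφ, ha, hb, hV, hW, hxW, haC, hbC, hab⟩ :=
      exists_chart_of_isIrreducible f hC hC' hx
    obtain ⟨O', hO', ⟨z₀, hz₀⟩, h⟩ := exists_isOpen_localDim_comap φ hφ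
    obtain ⟨O, hO, rfl⟩ := hb.isInducing.isOpen_iff.mp hO'
    have hmem (z : AffPt K B) : b z ∈ C ∩ W := hbC ▸ ⟨z, rfl⟩
    refine ⟨W ∩ O, hW.inter hO, ⟨b z₀, (hmem z₀).1, (hmem z₀).2, hz₀⟩, ?_⟩
    rintro z ⟨hzC, hzW, hzO⟩
    obtain ⟨z, rfl⟩ : z ∈ Set.range b := hbC ▸ ⟨hzC, hzW⟩
    have hB : dim C = ringKrullDim B := by
      rw [← (dimStable_pt X).dim_inter_eq C W hC hC' hW ⟨_, hzC, hzW⟩, ← hbC, dim_range hb,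
        topologicalKrullDim_affPt]
    have hA : dim (closure (onPt f '' C)) = ringKrullDim A := by
      rw [← (dimStable_pt Y).dim_inter_eq _ V (hC.image _ (continuous_onPt f).continuousOn).closure
        isClosed_closure hV ⟨a (comap φ z), haC ▸ ⟨_, rfl⟩⟩, ← haC, dim_range ha,
        topologicalKrullDim_affPt]
    rw [hA, hB, ← h z hzO, ← localDim_image hb, ← (dimStable_pt X).localDim_inter
      (hC'.inter (isClosed_onPt_fibre f _)) hW hzW]
    congr 2
    ext y
    constructor
    · rintro ⟨⟨hyC, hy⟩, hyW⟩
      obtain ⟨y, rfl⟩ : y ∈ Set.range b := hbC ▸ ⟨hyC, hyW⟩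
      refine ⟨y, ha.injective ?_, rfl⟩
      rw [← hab, ← hab]
      exact hy
    · rintro ⟨y, hy, rfl⟩
      refine ⟨⟨(hmem y).1, ?_⟩, (hmem y).2⟩
      change onPt f (b y) = onPt f (b z)
      rw [hab, hab, show comap φ y = comap φ z from hy]
  · obtain ⟨x, hx, hxU⟩ := hne
    obtain ⟨A, B, _, _, _, _, _, _, _, _, φ, a, b, V, W, hφ, ha, hb, hV, hW, hxW, haC, hbC, hab⟩ :=
      exists_chart_of_isIrreducible f hC hC' hx
    obtain ⟨z, rfl⟩ : x ∈ Set.range b := hbC ▸ ⟨hx, hxW⟩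
    obtain ⟨c, hc, h⟩ := exists_eval_ne_zero_subset_image φ hφ (hU.preimage hb.continuous) ⟨z, hxU⟩
    obtain ⟨V', hV', hcV⟩ := ha.isInducing.isOpen_iff.mp (isOpen_eval_ne_zero (K := K) c)
    refine ⟨V ∩ V', hV.inter hV', ?_, ?_⟩
    · obtain ⟨w, hw⟩ := exists_eval_ne_zero (K := K) hc
      have h1 : a w ∈ closure (onPt f '' C) ∩ V := haC ▸ ⟨w, rfl⟩
      have h2 : w ∈ a ⁻¹' V' := hcV ▸ hw
      exact ⟨a w, h1.1, h1.2, h2⟩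
    · rintro y ⟨hyC, hyV, hyV'⟩
      obtain ⟨w, rfl⟩ : y ∈ Set.range a := haC ▸ ⟨hyC, hyV⟩
      have h2 : w ∈ a ⁻¹' V' := hyV'
      rw [hcV] at h2
      obtain ⟨v, hv, rfl⟩ := h h2
      have h3 : b v ∈ C ∩ W := hbC ▸ ⟨v, rfl⟩
      exact ⟨b v, ⟨h3.1, hv⟩, hab v⟩

end GModality
end

noncomputable section

/-! ### Parameters and modality -/

namespace GModality

universe u

open TopologicalSpace Topology Limits

variable {K : Type u} [Field K]

theorem isEmbedding_onPt_of_isImmersion {X Z : Over (Spec (.of K))} [IsAlgClosed K]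
    [LocallyOfFiniteType Z.hom] (g : Z ⟶ X) [IsImmersion g.left] : IsEmbedding (onPt g) := by
  refine .of_comp (continuous_onPt g) (isInducing_toPoint X).continuous ?_
  rw [show toPoint ∘ onPt g = g.left ∘ toPoint from funext (toPoint_onPt g)]
  exact g.left.isEmbedding.comp ⟨isInducing_toPoint Z, toPoint_injective Z⟩

theorem range_onPt_of_isImmersion {X Z : Over (Spec (.of K))} [IsAlgClosed K]
    [LocallyOfFiniteType X.hom] [LocallyOfFiniteType Z.hom] (g : Z ⟶ X) [IsImmersion g.left] :
    Set.range (onPt g) = toPoint ⁻¹' Set.range g.left := by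
  ext x
  constructor
  · rintro ⟨z, rfl⟩
    exact ⟨toPoint z, rfl⟩
  · rintro ⟨z, hz⟩
    have hx : toPoint x ∈ closedPoints X.left := range_toPoint X ▸ ⟨x, rfl⟩
    -- As an immersion is injective, `{z}` is the inverse image of a closed point, so `z` is itself
    -- closed and comes from a `K`-point.
    have hz' : z ∈ Set.range (toPoint : Pt Z → Z.left) := by
      rw [range_toPoint]
      have e : {z} = g.left ⁻¹' {toPoint x} := by
        ext w
        rw [← hz]
        exact (g.left.isEmbedding.injective.eq_iff).symm
      change IsClosed {z}
      rw [e]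
      exact IsClosed.preimage g.left.continuous hx
    obtain ⟨z, rfl⟩ := hz'
    exact ⟨z, toPoint_injective X hz⟩

theorem isLocallyClosed_range_onPt {X Z : Over (Spec (.of K))} [IsAlgClosed K]
    [LocallyOfFiniteType X.hom] [LocallyOfFiniteType Z.hom] (g : Z ⟶ X) [IsImmersion g.left] :
    IsLocallyClosed (Set.range (onPt g)) := by
  rw [range_onPt_of_isImmersion]
  exact g.left.isLocallyClosed_range.preimage (isInducing_toPoint X).continuous

/-- The inverse image of a locally closed subvariety. -/
theorem exists_isPullback_of_isImmersion [IsAlgClosed K] {X X' S : Over (Spec (.of K))}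
    [LocallyOfFiniteType X'.hom]
    (h : X' ⟶ X) (i : S ⟶ X) [IsImmersion i.left] :
    ∃ (Z : Over (Spec (.of K))) (g : Z ⟶ X') (π : Z ⟶ S), IsImmersion g.left ∧
      LocallyOfFiniteType Z.hom ∧ g ≫ h = π ≫ i ∧
      ∀ (x : Pt X') (s : Pt S), onPt h x = onPt i s → ∃ z, onPt g z = x ∧ onPt π z = s := by
  let g' := pullback.fst h.left i.left
  let Z : Over (Spec (.of K)) := Over.mk (g' ≫ X'.hom)
  let g : Z ⟶ X' := Over.homMk g' rfl
  have w : pullback.snd h.left i.left ≫ S.hom = g' ≫ X'.hom := by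
    rw [← Over.w i, ← Over.w h, ← Category.assoc, ← pullback.condition, Category.assoc]
  let p : Z ⟶ S := Over.homMk (pullback.snd h.left i.left) w
  refine ⟨Z, g, p, inferInstanceAs (IsImmersion g'),
    inferInstanceAs (LocallyOfFiniteType (g' ≫ X'.hom)),
    Over.OverMorphism.ext pullback.condition, fun x s e => ?_⟩
  have e' : x.left ≫ h.left = s.left ≫ i.left := congr(($e).left)
  refine ⟨Over.homMk (pullback.lift x.left s.left e') ?_, ?_, ?_⟩
  · exact (pullback.lift_fst_assoc _ _ _ _).trans (Over.w x)
  · exact Over.OverMorphism.ext (pullback.lift_fst _ _ _)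
  · exact Over.OverMorphism.ext (pullback.lift_snd _ _ _)

/-! ### Arithmetic of dimensions in the extended reals -/

theorem toEReal_mono : Monotone toEReal := by
  intro a b h
  induction a using WithBot.recBotCoe with
  | bot => exact bot_le
  | coe a =>
    induction b using WithBot.recBotCoe with
    | bot => simp at h
    | coe b =>
      have : a ≤ b := WithBot.coe_le_coe.mp h
      exact EReal.coe_ennreal_le_coe_ennreal_iff.mpr (ENat.toENNReal_le.mpr this)

theorem toEReal_bot : toEReal ⊥ = ⊥ := rfl

theorem coe_ennreal_natCast (n : ℕ) : ((n : ENNReal) : EReal) = n :=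
  congrArg Real.toEReal (NNReal.coe_natCast n)

theorem toEReal_natCast (n : ℕ) : toEReal (n : WithBot ℕ∞) = n :=
  (congrArg _ (ENat.toENNReal_coe n)).trans (coe_ennreal_natCast n)

theorem toEReal_add_natCast (a : WithBot ℕ∞) (n : ℕ) : toEReal (a + n) = toEReal a + n := by
  induction a using WithBot.recBotCoe with
  | bot => simp [toEReal_bot]
  | coe a =>
    change (((a + n : ℕ∞) : ENNReal) : EReal) = ((a : ENNReal) : EReal) + n
    rw [ENat.toENNReal_add, EReal.coe_ennreal_add, ENat.toENNReal_coe, coe_ennreal_natCast]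

theorem toEReal_sub_natCast_le {a b : WithBot ℕ∞} {n : ℕ} (h : a ≤ b + n) :
    toEReal a - n ≤ toEReal b := by
  refine EReal.sub_le_of_le_add ?_
  rw [← toEReal_add_natCast]
  exact toEReal_mono h

theorem natCast_le_toEReal_sub {a : WithBot ℕ∞} {d n : ℕ} (h : (d + n : ℕ) ≤ a) :
    (d : EReal) ≤ toEReal a - n := by
  have h1 : ((d + n : ℕ) : EReal) ≤ toEReal a := toEReal_natCast (d + n) ▸ toEReal_mono h
  refine (EReal.le_sub_iff_add_le (.inl (EReal.natCast_ne_bot n)) (.inl (EReal.natCast_ne_top n))).mpr ?_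
  exact_mod_cast h1

variable (G : Over (Spec (.of K))) [GrpObj G] {X S : Over (Spec (.of K))} [ModObj G X] [ModObj G S]

theorem orbit_eq_iff {x y : Pt X} : orbit G x = orbit G y ↔ x ∈ orbit G y :=
  MulAction.orbit_eq_iff

theorem image_orbit (f : S ⟶ X) [IsModHom G f] (x : Pt S) :
    onPt f '' orbit G x = orbit G (onPt f x) := by
  ext y
  constructor
  · rintro ⟨_, ⟨g, rfl⟩, rfl⟩
    exact ⟨g, (IsModHom.map_smul f g x).symm⟩
  · rintro ⟨g, rfl⟩
    exact ⟨_, ⟨g, rfl⟩, IsModHom.map_smul f g x⟩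

variable {G}

instance (R : RosenlichtStratification G X) (j : Fin R.s) : ModObj G (R.stratum j) := R.action j

instance (R : RosenlichtStratification G X) (j : Fin R.s) : IsModHom G (R.incl j) := R.isModHom j

theorem onPt_id (x : Pt X) : onPt (𝟙 X) x = x := Category.comp_id x

variable (G) in
theorem parWrt_id (U : Set (Pt X)) : parWrt G (𝟙 X) U = par G U := by
  have e (x : Pt X) : orbitFiber G (𝟙 X) x = orbit G x := by
    ext y
    change orbit G (onPt _ y) = orbit G (onPt _ x) ↔ _
    rw [onPt_id, onPt_id, orbit_eq_iff]
  simp only [parWrt, par, parStratumWrt, parStratum, e]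

theorem modWrt_id (R : RosenlichtStratification G X) (U : Set (Pt X)) : modWrt R (𝟙 X) U = mod R U := by
  have e : onPt (𝟙 X) '' U = U := by
    rw [show onPt (𝟙 X) = id from funext onPt_id, Set.image_id]
  simp only [modWrt, mod, e]

variable [IsAlgClosed K] {X' : Over (Spec (.of K))}

/-- The inverse image `Z` in `X'` of a stratum, with its embedding `g` and its map `f` to the
orbit space. -/
theorem RosenlichtStratification.exists_preimage_stratum [LocallyOfFiniteType X'.hom]
    (R : RosenlichtStratification G X) (h : X' ⟶ X) (j : Fin R.s) :
    ∃ (Z : Over (Spec (.of K))) (g : Z ⟶ X') (f : Z ⟶ R.quot j), LocallyOfFiniteType Z.hom ∧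
      IsEmbedding (onPt g) ∧ IsLocallyClosed (Set.range (onPt g)) ∧
      onPt h ⁻¹' Set.range (onPt (R.incl j)) ⊆ Set.range (onPt g) ∧
      (∀ U', onPt (R.proj j) '' (onPt (R.incl j) ⁻¹' (onPt h '' U')) =
        onPt f '' (onPt g ⁻¹' U')) ∧
      ∀ U' i, onPt g ⁻¹' parStratumWrt G h U' i = fibreStratum (onPt f) (onPt g ⁻¹' U') i := by
  have := R.isImmersion j
  obtain ⟨Z, g, p, hg, hZ, w, hlift⟩ := exists_isPullback_of_isImmersion h (R.incl j)
  have w' (z : Pt Z) : onPt h (onPt g z) = onPt (R.incl j) (onPt p z) := by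
    simp only [onPt, Category.assoc, w]
  have e (z : Pt Z) : onPt (p ≫ R.proj j) z = onPt (R.proj j) (onPt p z) := by
    simp only [onPt, Category.assoc]
  have hfib (s t : Pt (R.stratum j)) :
      onPt (R.proj j) s = onPt (R.proj j) t ↔ s ∈ orbit G t := by
    rw [← (R.isGeometricQuotient j).fiber_eq_orbit]
    rfl
  have hemb := isEmbedding_onPt_of_isImmersion g
  refine ⟨Z, g, p ≫ R.proj j, hZ, hemb, isLocallyClosed_range_onPt g, ?_, fun U' => ?_,
    fun U' i => ?_⟩
  · rintro x ⟨s, hs⟩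
    obtain ⟨z, hz, -⟩ := hlift x s hs.symm
    exact ⟨z, hz⟩
  · ext y
    constructor
    · rintro ⟨s, ⟨x, hx, hs⟩, rfl⟩
      obtain ⟨z, rfl, rfl⟩ := hlift x s hs
      exact ⟨z, hx, e z⟩
    · rintro ⟨z, hz, rfl⟩
      exact ⟨onPt p z, ⟨onPt g z, hz, w' z⟩, (e z).symm⟩
  · ext z
    -- The set `V_{G,h}` is a fibre of the map to the orbit space: the orbit of `onPt h (onPt g z)`
    -- stays in the stratum by equivariance, so every `x` in `V_{G,h}` lifts to `Z`, and inside the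
    -- stratum orbits are the fibres of the quotient map.
    have key : U' ∩ orbitFiber G h (onPt g z) =
        onPt g '' (onPt g ⁻¹' U' ∩ onPt (p ≫ R.proj j) ⁻¹' {onPt (p ≫ R.proj j) z}) := by
      ext x
      constructor
      · rintro ⟨hx, hxz⟩
        have hxz' : onPt h x ∈ onPt (R.incl j) '' orbit G (onPt p z) := by
          rw [image_orbit, ← w']
          exact (orbit_eq_iff G).mp hxz
        obtain ⟨s, hs, hsx⟩ := hxz'
        obtain ⟨z', rfl, rfl⟩ := hlift x s hsx.symm
        refine ⟨z', ⟨hx, ?_⟩, rfl⟩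
        change onPt _ z' = onPt _ z
        rw [e, e, hfib]
        exact hs
      · rintro ⟨z', ⟨hz', hzz'⟩, rfl⟩
        refine ⟨hz', (orbit_eq_iff G).mpr ?_⟩
        rw [w', w', ← image_orbit]
        refine Set.mem_image_of_mem _ ((hfib _ _).mp ?_)
        rw [← e, ← e]
        exact hzz'
    change (onPt g z ∈ U' ∧ localDim _ _ = _) ↔ (onPt g z ∈ U' ∧ localDim _ _ = _)
    rw [key, localDim_image hemb]

/-! ### Equality of parameters and modality -/

variable [IsVariety X'] (R : RosenlichtStratification G X) (h : X' ⟶ X) {U' : Set (Pt X')}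

theorem parWrt_le_modWrt (hU : IsOpen U') : parWrt G h U' ≤ modWrt R h U' := by
  refine iSup_le fun i => ?_
  have : LocallyOfFiniteType X'.hom := IsVariety.locallyOfFiniteType
  have hQ (j) : LocallyOfFiniteType (R.quot j).hom :=
    (R.isGeometricQuotient j).isVariety.locallyOfFiniteType
  choose Z g f hZ hemb hloc hcov hmod hpar using R.exists_preimage_stratum h
  have hle : dim (parStratumWrt G h U' i) ≤
      (⨆ j, dim (onPt (R.proj j) '' (onPt (R.incl j) ⁻¹' (onPt h '' U')))) + i := by
    refine dim_le_of_subset_iUnion (fun j => onPt (g j) '' (onPt (g j) ⁻¹' parStratumWrt G h U' i))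
      (fun x hx => ?_) fun j C hC hC' => ?_
    · obtain ⟨j, hj, -⟩ := R.existsUnique_stratum (onPt h x)
      obtain ⟨z, rfl⟩ := hcov j hj
      exact Set.mem_iUnion.mpr ⟨j, z, hx, rfl⟩
    · obtain ⟨C, hCs, rfl⟩ := Set.subset_image_iff.mp hC
      have hC'' := (isIrreducible_image_iff (hemb j).isInducing).mp hC'
      have := hZ j
      -- The closure in `X'` is traded for the closure in `Z j`, where the fibre dimension bound
      -- applies.
      rw [(dimStable_pt _).dim_closure_image (hemb j) (hloc j) hC'']
      rw [hpar] at hCs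
      refine ((fibreDim_onPt (f j)).dim_closure_le (dimStable_pt _) (dimStable_pt _)
        (isClosed_onPt_fibre _) (hU.preimage (continuous_onPt _)) hC'' hCs).trans ?_
      rw [← hmod]
      gcongr
      exact le_iSup (fun j => dim (onPt (R.proj j) '' (onPt (R.incl j) ⁻¹' (onPt h '' U')))) j
  refine (toEReal_sub_natCast_le hle).trans ?_
  -- The finite supremum is attained, which moves `toEReal` inside it; with no strata it is `⊥`.
  cases isEmpty_or_nonempty (Fin R.s)
  · rw [iSup_of_empty]
    exact bot_le
  · obtain ⟨j, hj⟩ := exists_eq_ciSup_of_finite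
      (f := fun j => dim (onPt (R.proj j) '' (onPt (R.incl j) ⁻¹' (onPt h '' U'))))
    rw [← hj]
    exact le_iSup
      (fun j => toEReal (dim (onPt (R.proj j) '' (onPt (R.incl j) ⁻¹' (onPt h '' U'))))) j

theorem modWrt_le_parWrt (hU : IsOpen U') : modWrt R h U' ≤ parWrt G h U' := by
  refine iSup_le fun j => ?_
  have : LocallyOfFiniteType X'.hom := IsVariety.locallyOfFiniteType
  have : QuasiCompact X'.hom := IsVariety.quasiCompact
  have : LocallyOfFiniteType (R.quot j).hom :=
    (R.isGeometricQuotient j).isVariety.locallyOfFiniteType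
  obtain ⟨Z, g, f, hZ, hemb, -, -, hmod, hpar⟩ := R.exists_preimage_stratum h j
  rw [hmod]
  obtain hne | hne := (onPt g ⁻¹' U').eq_empty_or_nonempty
  · rw [hne, Set.image_empty, dim_empty]
    exact bot_le
  have := noetherianSpace_pt X'
  have : NoetherianSpace (Pt Z) := hemb.isInducing.noetherianSpace
  obtain ⟨i, d, hd, hdi⟩ := (fibreDim_onPt f).exists_dim_image_le (dimStable_pt _)
    (dimStable_pt _) (isClosed_onPt_fibre _) (hU.preimage (continuous_onPt g)) hne
  refine le_iSup_of_le i ?_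
  refine (toEReal_mono hd).trans ?_
  rw [toEReal_natCast]
  refine natCast_le_toEReal_sub (hdi.trans ?_)
  rw [← hpar, ← dim_image hemb]
  exact dim_mono (Set.image_preimage_subset _ _)

theorem parWrt_eq_modWrt (hU : IsOpen U') : parWrt G h U' = modWrt R h U' :=
  (parWrt_le_modWrt R h hU).antisymm (modWrt_le_parWrt R h hU)

theorem parAtWrt_eq_modAtWrt (x' : Pt X') : parAtWrt G h x' = modAtWrt R h x' :=
  iInf_congr fun _ => iInf_congr fun hU => iInf_congr fun _ => parWrt_eq_modWrt R h hU

theorem par_eq_mod [IsVariety X] {U : Set (Pt X)} (hU : IsOpen U) : par G U = mod R U := by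
  rw [← parWrt_id, ← modWrt_id, parWrt_eq_modWrt R _ hU]

theorem parAt_eq_modAt [IsVariety X] (x : Pt X) : parAt G x = modAt R x :=
  iInf_congr fun _ => iInf_congr fun hU => iInf_congr fun _ => par_eq_mod R hU

end GModality
end

theorem mainTheorem4 {K : Type*} [Field K] [IsAlgClosed K]
    (G X : Over (Spec (.of K))) [GrpObj G] [GModality.IsVariety G]
    [GModality.IsVariety X] [ModObj G X] :
    -- parameters and modality with respect to a morphism, on open sets and at points
    (∀ (X' : Over (Spec (.of K))) [GModality.IsVariety X'] (h : X' ⟶ X)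
      (R : GModality.RosenlichtStratification G X),
      (∀ U' : Set (GModality.Pt X'), IsOpen U' →
        GModality.parWrt G h U' = GModality.modWrt R h U') ∧
      (∀ x' : GModality.Pt X', GModality.parAtWrt G h x' = GModality.modAtWrt R h x')) ∧
    -- parameters and modality of the action, on open sets and at points
    (∀ R : GModality.RosenlichtStratification G X,
      (∀ U : Set (GModality.Pt X), IsOpen U → GModality.par G U = GModality.mod R U) ∧
      (∀ x : GModality.Pt X, GModality.parAt G x = GModality.modAt R x)) ∧
    -- independence of the Rosenlicht stratification
    (∀ R₁ R₂ : GModality.RosenlichtStratification G X,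
      (∀ (X' : Over (Spec (.of K))) [GModality.IsVariety X'] (h : X' ⟶ X),
        (∀ U' : Set (GModality.Pt X'), IsOpen U' →
          GModality.modWrt R₁ h U' = GModality.modWrt R₂ h U') ∧
        (∀ x' : GModality.Pt X', GModality.modAtWrt R₁ h x' = GModality.modAtWrt R₂ h x')) ∧
      (∀ U : Set (GModality.Pt X), IsOpen U → GModality.mod R₁ U = GModality.mod R₂ U) ∧
      (∀ x : GModality.Pt X, GModality.modAt R₁ x = GModality.modAt R₂ x)) := by
  refine ⟨fun X' _ h R => ⟨fun U' hU => GModality.parWrt_eq_modWrt R h hU,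
      GModality.parAtWrt_eq_modAtWrt R h⟩,
    fun R => ⟨fun U hU => GModality.par_eq_mod R hU, GModality.parAt_eq_modAt R⟩,
    fun R₁ R₂ => ⟨fun X' _ h => ⟨fun U' hU => ?_, fun x' => ?_⟩, fun U hU => ?_, fun x => ?_⟩⟩
  -- Each modality equals the number of parameters, which refers to no stratification.
  · rw [← GModality.parWrt_eq_modWrt R₁ h hU, GModality.parWrt_eq_modWrt R₂ h hU]
  · rw [← GModality.parAtWrt_eq_modAtWrt R₁, GModality.parAtWrt_eq_modAtWrt R₂]
  · rw [← GModality.par_eq_mod R₁ hU, GModality.par_eq_mod R₂ hU]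
  · rw [← GModality.parAt_eq_modAt R₁, GModality.parAt_eq_modAt R₂]
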